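/- Let $n\ge 1$ and consider an $n\times n$ input-queued switch in slotted time with queue lengths $q(t)=(q_{ij}(t))\in\mathbb{Z}_{\ge 0}^{n\times n}$ evolving by $$q_{ij}(t+1)=\max\{q_{ij}(t)+a_{ij}(t)-s_{ij}(t),\,0\},$$ where $s(t)$ is a permutation matrix chosen by the MaxWeight algorithm, i.e. a permutation matrix $s$ maximizing $\langle q(t),s\rangle=\sum_{ij}q_{ij}(t)s_{ij}$ (ties are broken by an arbitrary, possibly randomized, rule depending on $q(t)$ only, for instance uniformly at random). Let $\nu$ be a doubly stochastic $n\times n$ matrix with $\nu_{ij}>0$ for all $i,j$. For each $0<\epsilon<1$ consider such a switch in which the arrival vectors $a^{(\epsilon)}(t)\in\mathbb{Z}_{\ge0}^{n\times n}$ are i.i.d. over time $t$ and independent of the past queue lengths and of the scheduling decisions up to time $t$, the components $a^{(\epsilon)}_{ij}(t)$ are independent across pairs $(i,j)$ and bounded by a constant $a_{\max}$ not depending on $\epsilon$, and $$\mathbb{E}[a^{(\epsilon)}_{ij}(t)]=(1-\epsilon)\nu_{ij},\qquad \mathrm{Var}[a^{(\epsilon)}_{ij}(t)]=(\sigma^{(\epsilon)}_{ij})^2\longrightarrow\sigma_{ij}^2\quad\text{as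 }\epsilon\downarrow0 .$$ Write $\|\sigma\|^2=\sum_{ij}\sigma_{ij}^2$. Then for every $0<\epsilon<1$ the queue length Markov chain has exactly one stationary law, $q^{(\epsilon)}(t)$ converges in distribution to it from every initial state, and a random vector $\bar q^{(\epsilon)}$ with this law has integrable components. In the heavy traffic limit, $$\lim_{\epsilon\downarrow0}\epsilon\,\mathbb{E}\Big[\sum_{ij}\bar q^{(\epsilon)}_{ij}\Big]=\Big(1-\frac1{2n}\Big)\|\sigma\|^2,\qquad \lim_{\epsilon\downarrow0}\epsilon\,\mathbb{E}\Big[\sum_{ij}\nu_{ij}\bar q^{(\epsilon)}_{ij}\Big]=\frac{2n-1}{2n^2}\|\sigma\|^2,$$ and, for every permutation $\pi$ of $\{1,\dots,n\}$, $$\lim_{\epsilon\downarrow0}\epsilon\,\mathbb{E}\Big[\sum_{i}\bar q^{(\epsilon)}_{i\pi(i)}\Big]=\frac{2n-1}{2n^2}\|\sigma\|^2 .$$ -/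

import Mathlib

open Filter Topology MeasureTheory ProbabilityTheory

noncomputable section

/-- A nonnegative integer for every (input port, output port) pair: a vector of queue lengths,
or the vector of packets that arrive in one time slot. -/
abbrev SwitchState (n : ℕ) : Type := Fin n → Fin n → ℕ

/-- The service offered to the pair `(i, j)` by a maximal schedule. Maximal schedules are the
perfect matchings of inputs with outputs: the permutation `τ` connects input `i` to
output `τ i`. -/
def switchService {n : ℕ} (τ : Equiv.Perm (Fin n)) (i j : Fin n) : ℕ :=
  if τ i = j then 1 else 0

/-- The weight `⟨q, s⟩` of a schedule, given the queue lengths `q`. -/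
def scheduleWeight {n : ℕ} (q : SwitchState n) (τ : Equiv.Perm (Fin n)) : ℕ :=
  ∑ i, ∑ j, q i j * switchService τ i j

/-- A (randomized) scheduling rule is a MaxWeight rule if, whatever the queue lengths are, it only
picks schedules of maximal weight. The way ties are broken is arbitrary (for instance uniformly at
random). -/
def IsMaxWeight {n : ℕ} (S : SwitchState n → PMF (Equiv.Perm (Fin n))) : Prop :=
  ∀ q, ∀ τ ∈ (S q).support, ∀ τ', scheduleWeight q τ' ≤ scheduleWeight q τ

/-- `q(t+1) = [q(t) + a(t) - s(t)]⁺`, componentwise; subtraction of natural numbers is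
truncated at `0`. -/
def nextQueue {n : ℕ} (q a : SwitchState n) (τ : Equiv.Perm (Fin n)) : SwitchState n :=
  fun i j => q i j + a i j - switchService τ i j

/-- One step of the queue length Markov chain: given the queue lengths `q`, the schedule is drawn
from `S q` and, independently, the arrivals are drawn from `A`. -/
def switchStep {n : ℕ} (A : PMF (SwitchState n)) (S : SwitchState n → PMF (Equiv.Perm (Fin n)))
    (q : SwitchState n) : PMF (SwitchState n) :=
  (S q).bind fun τ => A.map fun a => nextQueue q a τ

/-- The law of the queue lengths at time `t` when the queue lengths at time `0` are `q₀`
(arrivals are i.i.d. over time). -/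
def queueLaw {n : ℕ} (A : PMF (SwitchState n)) (S : SwitchState n → PMF (Equiv.Perm (Fin n)))
    (q₀ : SwitchState n) : ℕ → PMF (SwitchState n)
  | 0 => PMF.pure q₀
  | t + 1 => (queueLaw A S q₀ t).bind (switchStep A S)

/-- `Q` is a stationary law of the queue length Markov chain. -/
def IsStationaryLaw {n : ℕ} (A : PMF (SwitchState n))
    (S : SwitchState n → PMF (Equiv.Perm (Fin n))) (Q : PMF (SwitchState n)) : Prop :=
  Q.bind (switchStep A S) = Q

/-- `A` is the law of the arrivals of one time slot: independent across the input-output pairs,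
at most `amax` at each pair, with mean arrival rates `rate`. -/
structure IsArrivalLaw {n : ℕ} (A : PMF (SwitchState n)) (amax : ℕ)
    (rate : Matrix (Fin n) (Fin n) ℝ) : Prop where
  indep : iIndepFun (fun (p : Fin n × Fin n) (a : SwitchState n) => a p.1 p.2) A.toMeasure
  bounded : ∀ a ∈ A.support, ∀ i j, a i j ≤ amax
  mean : ∀ i j, ∫ a, (a i j : ℝ) ∂A.toMeasure = rate i j

end

/-! Three mechanisms carry the proof.

Ergodicity. Since `ν` has entries at least some `δ > 0` and MaxWeight does at least as well as `ν`
(Birkhoff), the Euclidean norm of the queues drifts down far from the origin, so its exponential has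
a geometric drift (`exists_exp_drift`). A slot has no arrivals with positive probability, and
MaxWeight then drains the switch, so the empty state is reached uniformly from bounded sets
(`pow_le_chainLaw_zero`). Harris' theorem, proved here by contraction of a weighted oscillation,
gives a unique stationary law, convergence to it and moments of every order.

State space collapse. If `q` is at distance `D` from the cone of nonnegative matrices `w i + v j`,
then `ν` can be tilted by an amount `δ` in the direction normal to the cone and stay doubly
stochastic, so the MaxWeight schedule beats `ν` by at least `δ * D`. On the cone all doubly
stochastic matrices have equal weight. Hence the distance has a drift bounded away from zero
uniformly in small `ε`, and its stationary second moment stays bounded while `q` itself grows like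
`1/ε` (`integral_coneDist_sq_le`).

Quadratic form. Let `B` be the quadratic form of the orthogonal projection onto the matrices `w i +
v j`, a space of dimension `2n - 1`. It sees only row and column sums, and every schedule has all of
these equal to `1`; so, before truncation at zero, the mean change of `B` does not depend on the
schedule: it is `-(2ε/n) ∑ q + (2n-1)/n² ∑ Var + ε²`. Truncation adds the unused service `u`, which
is orthogonal to the new queues; for queues on the cone this would make the cross term vanish, and
in general it is at most a multiple of `D * ∑ u`. As `E ∑ u = nε` and `E D²` is bounded, the error
is `O(√ε)`. Setting the stationary mean change of `B` to zero gives the limit of `ε E ∑ q`. By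
collapse, the weight of any doubly stochastic matrix differs from `(∑ q)/n` by a quantity of bounded
mean, which gives the other two limits. -/

noncomputable section

/-! ### Integration against discrete laws and their mixtures. -/

section PMFIntegral

variable {X Y : Type*} [MeasurableSpace X] [DiscreteMeasurableSpace X] [MeasurableSpace Y]

lemma PMF.ae_toMeasure_iff (p : PMF X) {φ : X → Prop} :
    (∀ᵐ x ∂p.toMeasure, φ x) ↔ ∀ x ∈ p.support, φ x := by
  rw [ae_iff, p.toMeasure_apply_eq_zero_iff (MeasurableSet.of_discrete), Set.disjoint_left]
  simp

lemma PMF.integrable_of_finite_support {p : PMF X} (hp : p.support.Finite) (f : X → ℝ) :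
    Integrable f p.toMeasure := by
  rw [← p.restrict_toMeasure_support]
  exact IntegrableOn.of_finite hp

lemma PMF.integral_mono_of_support {p : PMF X} {f g : X → ℝ} (hf : Integrable f p.toMeasure)
    (hg : Integrable g p.toMeasure) (h : ∀ x ∈ p.support, f x ≤ g x) :
    ∫ x, f x ∂p.toMeasure ≤ ∫ x, g x ∂p.toMeasure :=
  integral_mono_ae hf hg (p.ae_toMeasure_iff.2 h)

lemma PMF.toMeasure_bind [Countable X] (p : PMF X) (k : X → PMF Y) :
    (p.bind k).toMeasure =
      Measure.bind p.toMeasure (Kernel.ofFunOfCountable fun x => (k x).toMeasure) := by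
  ext s hs
  rw [Measure.bind_apply hs (Kernel.aemeasurable _), lintegral_countable',
    PMF.toMeasure_bind_apply _ _ _ hs]
  refine tsum_congr fun x => ?_
  rw [p.toMeasure_apply_singleton _ MeasurableSet.of_discrete, mul_comm]
  rfl

lemma PMF.toMeasure_bind_eq_comp [Countable X] (p : PMF X) (k : X → PMF Y) :
    (p.bind k).toMeasure =
      ((Kernel.ofFunOfCountable fun x => (k x).toMeasure) ∘ₖ
        (Kernel.const Unit p.toMeasure)) () := by
  rw [PMF.toMeasure_bind, Measure.comp_eq_comp_const_apply]

lemma PMF.integrable_integral_bind [Countable X] {p : PMF X} {k : X → PMF Y} {f : Y → ℝ}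
    (hf : Integrable f (p.bind k).toMeasure) :
    Integrable (fun x => ∫ y, f y ∂(k x).toMeasure) p.toMeasure := by
  rw [PMF.toMeasure_bind_eq_comp] at hf
  have := hf.integral_comp
  rwa [Kernel.const_apply] at this

lemma PMF.integral_bind [Countable X] {p : PMF X} {k : X → PMF Y} {f : Y → ℝ}
    (hf : Integrable f (p.bind k).toMeasure) :
    ∫ y, f y ∂(p.bind k).toMeasure = ∫ x, ∫ y, f y ∂(k x).toMeasure ∂p.toMeasure := by
  rw [PMF.toMeasure_bind_eq_comp] at hf ⊢
  rw [Kernel.integral_comp hf, Kernel.const_apply]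
  rfl

lemma PMF.integral_indicator_singleton (p : PMF X) (z : X) :
    ∫ x, ({z} : Set X).indicator 1 x ∂p.toMeasure = (p z).toReal := by
  rw [integral_indicator_one MeasurableSet.of_discrete, measureReal_def,
    p.toMeasure_apply_singleton _ MeasurableSet.of_discrete]

end PMFIntegral

lemma PMF.finite_support_bind {X Y : Type*} {p : PMF X} {k : X → PMF Y} (hp : p.support.Finite)
    (hk : ∀ x, (k x).support.Finite) : (p.bind k).support.Finite := by
  rw [PMF.support_bind]
  exact hp.biUnion fun x _ => hk x

/-! ### Harris' theorem: drift and minorization give geometric contraction. -/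

section Chain

variable {X : Type*}

/-- The law at time `t` of the Markov chain with transition laws `P`, started at `x`. -/
def chainLaw (P : X → PMF X) (x : X) : ℕ → PMF X
  | 0 => PMF.pure x
  | t + 1 => (chainLaw P x t).bind P

lemma chainLaw_add (P : X → PMF X) (x : X) (s t : ℕ) :
    chainLaw P x (s + t) = (chainLaw P x s).bind fun y => chainLaw P y t := by
  induction t with
  | zero => simp [chainLaw, PMF.bind_pure]
  | succ t ih => rw [← add_assoc, chainLaw, ih, PMF.bind_bind]; rfl

lemma chainLaw_one (P : X → PMF X) (x : X) : chainLaw P x 1 = P x := by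
  simp [chainLaw, PMF.pure_bind]

lemma chainLaw_succ' (P : X → PMF X) (x : X) (t : ℕ) :
    chainLaw P x (t + 1) = (P x).bind fun y => chainLaw P y t := by
  rw [add_comm, chainLaw_add, chainLaw_one]

lemma bind_chainLaw_of_stationary {P : X → PMF X} {Q : PMF X} (hQ : Q.bind P = Q) (t : ℕ) :
    (Q.bind fun x => chainLaw P x t) = Q := by
  induction t with
  | zero => simp [chainLaw, PMF.bind_pure]
  | succ t ih =>
    simp only [chainLaw]
    rw [← PMF.bind_bind, ih, hQ]

lemma finite_support_chainLaw {P : X → PMF X} (hP : ∀ x, (P x).support.Finite) (x : X) (t : ℕ) :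
    (chainLaw P x t).support.Finite := by
  induction t with
  | zero => simp [chainLaw, PMF.support_pure]
  | succ t ih => exact PMF.finite_support_bind ih hP

variable [MeasurableSpace X] [DiscreteMeasurableSpace X]

/-- One step of the Hairer–Mattingly argument: a transition contracts the Lipschitz seminorm for the
metric `2 + β * (V x + V y)` on distinct points. Run two copies independently. If both start low,
they meet at the atom `o` with probability at least `η ^ 2`; if one starts high, the drift of `V`
already shrinks the metric. A small weight `β` makes the two cases compatible. -/
lemma integral_sub_integral_le_of_minorization {R : X → PMF X} (hR : ∀ x, (R x).support.Finite)
    {V : X → ℝ} (hV : ∀ x, 0 ≤ V x) {γ K L η : ℝ} (hγ0 : 0 ≤ γ) (hγ : γ < 1) (hK : 0 ≤ K)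
    (hL : 0 < L) (hKL : 4 * K ≤ (1 - γ) * L) (hη : 0 < η)
    (hdrift : ∀ x, ∫ y, V y ∂(R x).toMeasure ≤ γ * V x + K) {o : X}
    (hmin : ∀ x, V x ≤ L → η ≤ (R x o).toReal) :
    ∃ α β : ℝ, 0 < α ∧ α < 1 ∧ 0 < β ∧ ∀ (f : X → ℝ) (c : ℝ), 0 ≤ c →
      (∀ x y, x ≠ y → f x - f y ≤ c * (2 + β * (V x + V y))) →
      ∀ x y, x ≠ y → ∫ z, f z ∂(R x).toMeasure - ∫ z, f z ∂(R y).toMeasure ≤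
        α * c * (2 + β * (V x + V y)) := by
  classical
  -- The drift constants of the two copies cost `2 * β * K`; this must not exceed half of the gain
  -- `2 * η ^ 2` from meeting at the atom.
  obtain ⟨β, hβ, hβK⟩ : ∃ β : ℝ, 0 < β ∧ 2 * β * K ≤ η ^ 2 := by
    refine ⟨η ^ 2 / (2 * K + 1), by positivity, ?_⟩
    rw [mul_div_assoc', div_mul_eq_mul_div, div_le_iff₀ (by positivity)]
    nlinarith [sq_nonneg η]
  -- For far pairs, half of the margin `1 - γ` pays for `K`, leaving the rate `γ'`; `α₂` is the
  -- resulting contraction factor at `V x + V y = L`, the worst case.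
  set γ' : ℝ := (1 + γ) / 2 with hγ'
  set α₂ : ℝ := (2 + β * γ' * L) / (2 + β * L) with hα₂
  have hden : 0 < 2 + β * L := by positivity
  have hα₂1 : α₂ < 1 := by
    rw [hα₂, div_lt_one hden]
    have : γ' < 1 := by rw [hγ']; linarith
    nlinarith [mul_pos hβ hL]
  have hα₂0 : 0 < α₂ := by
    have : 0 ≤ γ' := by rw [hγ']; linarith
    positivity
  set α := max α₂ (max γ (1 - η ^ 2 / 2)) with hα
  have hαα₂ : α₂ ≤ α := le_max_left _ _
  have hαγ : γ ≤ α := (le_max_left _ _).trans (le_max_right _ _)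
  have hαη : 1 - η ^ 2 / 2 ≤ α := (le_max_right _ _).trans (le_max_right _ _)
  refine ⟨α, β, hα₂0.trans_le hαα₂, ?_, hβ, ?_⟩
  · refine max_lt hα₂1 (max_lt hγ ?_)
    have := pow_pos hη 2
    linarith
  intro f c hc hf x y _
  set I : X → ℝ := ({o} : Set X).indicator 1 with hI
  have hint : ∀ (g : X → ℝ) x, Integrable g (R x).toMeasure := fun g x =>
    PMF.integrable_of_finite_support (hR x) g
  -- The metric vanishes on the diagonal. Only the coincidence at `o` is exploited, which keeps the
  -- bound integrable against a product law.
  have hpt : ∀ a b, f a - f b ≤ c * (2 + β * (V a + V b) - 2 * (I a * I b)) := by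
    intro a b
    by_cases hab : a = b
    · subst hab
      have : I a * I a ≤ 1 := by
        by_cases h : a = o <;> simp [hI, h]
      rw [sub_self]
      refine mul_nonneg hc ?_
      nlinarith [mul_nonneg hβ.le (hV a)]
    · have : I a * I b = 0 := by
        by_cases h : a = o
        · have : b ≠ o := fun h' => hab (h.trans h'.symm)
          simp [hI, this]
        · simp [hI, h]
      rw [this]
      simpa using hf a b hab
  have hoR : ∀ x, ∫ z, I z ∂(R x).toMeasure = (R x o).toReal := fun x =>
    (R x).integral_indicator_singleton o
  have h1 : ∀ a, f a - ∫ z, f z ∂(R y).toMeasure ≤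
      c * (2 + β * (V a + ∫ z, V z ∂(R y).toMeasure) - 2 * (I a * (R y o).toReal)) := by
    intro a
    have := integral_mono (hint (fun b => f a - f b) y)
      (hint (fun b => c * (2 + β * (V a + V b) - 2 * (I a * I b))) y) (hpt a)
    rw [integral_sub (hint _ _) (hint _ _), integral_const_mul,
      integral_sub (hint _ _) (hint _ _), integral_add (hint _ _) (hint _ _), integral_const_mul,
      integral_add (hint _ _) (hint _ _), integral_const_mul, integral_const_mul, hoR] at this
    simpa using this
  have h2 : ∫ z, f z ∂(R x).toMeasure - ∫ z, f z ∂(R y).toMeasure ≤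
      c * (2 + β * (∫ z, V z ∂(R x).toMeasure + ∫ z, V z ∂(R y).toMeasure)
        - 2 * ((R x o).toReal * (R y o).toReal)) := by
    have := integral_mono (hint (fun a => f a - ∫ z, f z ∂(R y).toMeasure) x)
      (hint (fun a => c * (2 + β * (V a + ∫ z, V z ∂(R y).toMeasure)
        - 2 * (I a * (R y o).toReal))) x) h1
    rw [integral_sub (hint _ _) (hint _ _), integral_const_mul,
      integral_sub (hint _ _) (hint _ _), integral_add (hint _ _) (hint _ _), integral_const_mul,
      integral_add (hint _ _) (hint _ _), integral_const_mul, integral_mul_const, hoR] at this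
    simpa using this
  refine h2.trans ?_
  rw [mul_comm α c, mul_assoc]
  refine mul_le_mul_of_nonneg_left ?_ hc
  have hdx := hdrift x
  have hdy := hdrift y
  have hs : 0 ≤ V x + V y := add_nonneg (hV x) (hV y)
  set s := V x + V y with hsdef
  have hd : β * (∫ z, V z ∂(R x).toMeasure + ∫ z, V z ∂(R y).toMeasure) ≤
      β * (γ * s + 2 * K) := mul_le_mul_of_nonneg_left (by rw [hsdef]; linarith) hβ.le
  -- Near pairs use the mass of both laws at the atom; for far pairs `V x + V y ≥ L` and the drift
  -- suffices.
  by_cases hnear : V x ≤ L ∧ V y ≤ L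
  · have hx := hmin x hnear.1
    have hy := hmin y hnear.2
    have hxy : η ^ 2 ≤ (R x o).toReal * (R y o).toReal := by nlinarith
    have h3 : γ * (β * s) ≤ α * (β * s) := mul_le_mul_of_nonneg_right hαγ (by positivity)
    nlinarith
  · have hsL : L ≤ s := by
      rw [not_and_or, not_le, not_le] at hnear
      rcases hnear with h | h <;> [have := hV y; have := hV x] <;> linarith
    have h3 : 2 + β * γ' * s ≤ α₂ * (2 + β * s) := by
      rw [hα₂, div_mul_eq_mul_div, le_div_iff₀ hden]
      have : 0 ≤ β * (1 - γ') * (s - L) :=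
        mul_nonneg (mul_nonneg hβ.le (by rw [hγ']; linarith)) (by linarith)
      nlinarith
    have h4 : α₂ * (2 + β * s) ≤ α * (2 + β * s) :=
      mul_le_mul_of_nonneg_right hαα₂ (by positivity)
    have h5 : 0 ≤ (R x o).toReal * (R y o).toReal := by positivity
    have h6 : 2 * K ≤ (1 - γ) / 2 * s := by nlinarith
    have h7 : β * (γ * s + 2 * K) ≤ β * γ' * s := by
      rw [mul_assoc]
      refine mul_le_mul_of_nonneg_left ?_ hβ.le
      rw [hγ']; linarith
    linarith

variable [Countable X]

lemma integral_chainLaw_add {P : X → PMF X} (hP : ∀ x, (P x).support.Finite) (f : X → ℝ) (x : X)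
    (s t : ℕ) : ∫ z, f z ∂(chainLaw P x (s + t)).toMeasure =
      ∫ y, ∫ z, f z ∂(chainLaw P y t).toMeasure ∂(chainLaw P x s).toMeasure := by
  rw [chainLaw_add, PMF.integral_bind]
  rw [← chainLaw_add]
  exact PMF.integrable_of_finite_support (finite_support_chainLaw hP x _) f

lemma integral_chainLaw_le_of_drift {P : X → PMF X} (hP : ∀ x, (P x).support.Finite)
    {V : X → ℝ} {γ K : ℝ} (hγ0 : 0 ≤ γ) (hγ : γ < 1)
    (hK : 0 ≤ K) (hdrift : ∀ x, ∫ y, V y ∂(P x).toMeasure ≤ γ * V x + K) (x : X) (t : ℕ) :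
    ∫ y, V y ∂(chainLaw P x t).toMeasure ≤ γ ^ t * V x + K / (1 - γ) := by
  have h1 : 0 < 1 - γ := by linarith
  have hint : ∀ (g : X → ℝ) x t, Integrable g (chainLaw P x t).toMeasure := fun g x t =>
    PMF.integrable_of_finite_support (finite_support_chainLaw hP x t) g
  induction t with
  | zero =>
    have : 0 ≤ K / (1 - γ) := by positivity
    simpa [chainLaw, PMF.toMeasure_pure] using this
  | succ t ih =>
    rw [integral_chainLaw_add hP]
    simp only [chainLaw_one]
    have := integral_mono (hint (fun y => ∫ z, V z ∂(P y).toMeasure) x t)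
      (hint (fun y => γ * V y + K) x t) hdrift
    rw [integral_add (hint _ _ _) (hint _ _ _), integral_const_mul] at this
    simp only [integral_const, probReal_univ, smul_eq_mul, one_mul] at this
    refine this.trans ?_
    have h2 : γ * (K / (1 - γ)) + K = K / (1 - γ) := by field_simp; ring
    have h3 := mul_le_mul_of_nonneg_left ih hγ0
    rw [pow_succ]
    nlinarith

/-- Geometric ergodicity, in the weak form that is needed here: a chain with a geometric drift
and a uniformly accessible atom forgets its initial state. -/
lemma exists_abs_integral_chainLaw_sub_le {P : X → PMF X} (hP : ∀ x, (P x).support.Finite)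
    {V : X → ℝ} (hV : ∀ x, 0 ≤ V x) {γ K : ℝ} (hγ0 : 0 ≤ γ) (hγ : γ < 1) (hK : 0 ≤ K)
    (hdrift : ∀ x, ∫ y, V y ∂(P x).toMeasure ≤ γ * V x + K) {o : X}
    (hmin : ∀ L, ∃ N₀, ∀ N ≥ N₀, ∃ η > 0, ∀ x, V x ≤ L → η ≤ (chainLaw P x N o).toReal) :
    ∃ ρ β C : ℝ, 0 < ρ ∧ ρ < 1 ∧ 0 < β ∧ 0 ≤ C ∧ ∀ f : X → ℝ, (∀ x, 0 ≤ f x) → (∀ x, f x ≤ 1) →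
      ∀ t x y, |∫ z, f z ∂(chainLaw P x t).toMeasure - ∫ z, f z ∂(chainLaw P y t).toMeasure| ≤
        C * ρ ^ t * (2 + β * (V x + V y)) := by
  have h1γ : 0 < 1 - γ := by linarith
  set K' := K / (1 - γ) with hK'
  have hK'0 : 0 ≤ K' := by positivity
  -- The level `8 * K' + 1` suits an `N`-step chain with drift factor `1 / 2` and constant `K'`,
  -- since the contraction needs `4 * K' ≤ (1 / 2) * L`.
  obtain ⟨N₀, hN₀⟩ := hmin (8 * K' + 1)
  obtain ⟨N₁, hN₁⟩ := exists_pow_lt_of_lt_one (show (0 : ℝ) < 1 / 2 by norm_num) hγ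
  obtain ⟨N, hN⟩ : ∃ N, N = N₀ + N₁ + 1 := ⟨_, rfl⟩
  obtain ⟨η, hη, hηmin⟩ := hN₀ N (by omega)
  have hγN : γ ^ N ≤ 1 / 2 :=
    (pow_le_pow_of_le_one hγ0 hγ.le (by omega : N₁ ≤ N)).trans hN₁.le
  have hint : ∀ (g : X → ℝ) x t, Integrable g (chainLaw P x t).toMeasure := fun g x t =>
    PMF.integrable_of_finite_support (finite_support_chainLaw hP x t) g
  obtain ⟨α, β, hα0, hα1, hβ, hcontr⟩ := integral_sub_integral_le_of_minorization
    (R := fun x => chainLaw P x N) (fun x => finite_support_chainLaw hP x N) hV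
    (γ := 1 / 2) (K := K') (L := 8 * K' + 1) (η := η) (by norm_num) (by norm_num) hK'0
    (by positivity) (by linarith) hη
    (fun x => (integral_chainLaw_le_of_drift hP hγ0 hγ hK hdrift x N).trans
      (by have := mul_le_mul_of_nonneg_right hγN (hV x); linarith)) hηmin
  have hw : ∀ x y, 0 ≤ 2 + β * (V x + V y) := fun x y => by
    have := hV x; have := hV y; positivity
  have hblock : ∀ f : X → ℝ, (∀ x, 0 ≤ f x) → (∀ x, f x ≤ 1) → ∀ k x y, x ≠ y →
      ∫ z, f z ∂(chainLaw P x (N * k)).toMeasure - ∫ z, f z ∂(chainLaw P y (N * k)).toMeasure ≤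
        α ^ k * (2 + β * (V x + V y)) := by
    intro f hf0 hf1 k
    induction k with
    | zero =>
      intro x y _
      have := hf1 x; have := hf0 y; have := hV x; have := hV y
      have : 0 ≤ β * (V x + V y) := by positivity
      simp only [mul_zero, chainLaw, PMF.toMeasure_pure, integral_dirac, pow_zero, one_mul]
      linarith
    | succ k ih =>
      intro x y hxy
      rw [show N * (k + 1) = N + N * k by ring, integral_chainLaw_add hP,
        integral_chainLaw_add hP, pow_succ']
      exact hcontr _ _ (by positivity) ih x y hxy
  have hNpos : (0 : ℝ) < N := by rw [hN]; positivity
  -- The factor `α` per block of `N` steps is spread over single steps; `α⁻¹` covers the incomplete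
  -- block `t % N`.
  refine ⟨α ^ (1 / (N : ℝ)), β, α⁻¹, by positivity, Real.rpow_lt_one hα0.le hα1 (by positivity),
    hβ, by positivity, ?_⟩
  intro f hf0 hf1 t
  have hone : ∀ x y, x ≠ y →
      ∫ z, f z ∂(chainLaw P x t).toMeasure - ∫ z, f z ∂(chainLaw P y t).toMeasure ≤
        α⁻¹ * (α ^ (1 / (N : ℝ))) ^ t * (2 + β * (V x + V y)) := by
    intro x y hxy
    have hg0 : ∀ x, 0 ≤ ∫ z, f z ∂(chainLaw P x (t % N)).toMeasure := fun x =>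
      integral_nonneg hf0
    have hg1 : ∀ x, ∫ z, f z ∂(chainLaw P x (t % N)).toMeasure ≤ 1 := fun x => by
      have := integral_mono (hint f x (t % N)) (hint (fun _ => 1) x (t % N)) hf1
      simpa using this
    have := hblock _ hg0 hg1 (t / N) x y hxy
    rw [← integral_chainLaw_add hP, ← integral_chainLaw_add hP, Nat.div_add_mod] at this
    refine this.trans (mul_le_mul_of_nonneg_right ?_ (hw x y))
    rw [← Real.rpow_natCast, ← Real.rpow_natCast, ← Real.rpow_mul hα0.le, ← Real.rpow_neg_one,
      ← Real.rpow_add hα0]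
    refine Real.rpow_le_rpow_of_exponent_ge hα0 hα1.le ?_
    have h1 := Nat.lt_div_mul_add (a := t) (b := N) (by omega)
    have h2 : (t : ℝ) < (t / N : ℕ) * N + N := by exact_mod_cast h1
    rw [one_div, ← div_eq_inv_mul, neg_add_eq_sub, sub_le_iff_le_add, div_le_iff₀ hNpos]
    linarith
  intro x y
  by_cases hxy : x = y
  · subst hxy
    rw [sub_self, abs_zero]
    have := hw x x
    positivity
  · refine abs_sub_le_iff.2 ⟨hone x y hxy, ?_⟩
    rw [add_comm (V x)]
    exact hone y x (Ne.symm hxy)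

end Chain

lemma PMF.eq_of_forall_le {X : Type*} {p q : PMF X} (h : ∀ x, p x ≤ q x) : p = q := by
  ext x
  by_contra hx
  have := ENNReal.tsum_lt_tsum (by rw [p.tsum_coe]; exact ENNReal.one_ne_top) h
    (lt_of_le_of_ne (h x) hx)
  rw [p.tsum_coe, q.tsum_coe] at this
  exact lt_irrefl _ this

/-! ### Existence, uniqueness and limits of the stationary law. -/

section Ergodic

variable {X : Type*} [MeasurableSpace X] [DiscreteMeasurableSpace X]

/-- Finite partial sums survive pointwise limits of laws, which is how a uniform bound on the mean
of `V` passes to the limit law. -/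
lemma sum_mul_toReal_le_integral {p : PMF X} {f : X → ℝ} (hf : Integrable f p.toMeasure)
    (hf0 : ∀ x, 0 ≤ f x) (F : Finset X) :
    ∑ z ∈ F, f z * (p z).toReal ≤ ∫ x, f x ∂p.toMeasure := by
  classical
  have h1 : ∀ z, Integrable (fun x => f z * ({z} : Set X).indicator 1 x) p.toMeasure := fun z =>
    ((integrable_const (1 : ℝ)).indicator MeasurableSet.of_discrete).const_mul _
  have h2 : ∑ z ∈ F, f z * (p z).toReal =
      ∫ x, ∑ z ∈ F, f z * ({z} : Set X).indicator 1 x ∂p.toMeasure := by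
    rw [integral_finsetSum _ fun z _ => h1 z]
    simp only [integral_const_mul, p.integral_indicator_singleton]
  rw [h2]
  refine integral_mono (integrable_finsetSum _ fun z _ => h1 z) hf fun x => ?_
  by_cases hx : x ∈ F
  · rw [Finset.sum_eq_single x]
    · simp
    · intro z _ hz; simp [Ne.symm hz]
    · simp [hx]
  · rw [Finset.sum_eq_zero]
    · exact hf0 x
    · intro z hz
      have : x ≠ z := fun h => hx (h ▸ hz)
      simp [this]

variable [Countable X]

/-- Stationary law of a chain with a geometric drift and a uniformly accessible atom. -/
theorem exists_stationary_of_drift {P : X → PMF X} (hP : ∀ x, (P x).support.Finite)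
    {V : X → ℝ} (hV : ∀ x, 0 ≤ V x) (hVfin : ∀ L, {x | V x ≤ L}.Finite)
    {γ K : ℝ} (hγ0 : 0 ≤ γ) (hγ : γ < 1) (hK : 0 ≤ K)
    (hdrift : ∀ x, ∫ y, V y ∂(P x).toMeasure ≤ γ * V x + K) {o : X}
    (hmin : ∀ L, ∃ N₀, ∀ N ≥ N₀, ∃ η > 0, ∀ x, V x ≤ L → η ≤ (chainLaw P x N o).toReal) :
    ∃ Q : PMF X, Q.bind P = Q ∧ Integrable V Q.toMeasure ∧
      (∀ x z, Tendsto (fun t => chainLaw P x t z) atTop (𝓝 (Q z))) ∧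
      ∀ Q' : PMF X, Q'.bind P = Q' → Q' = Q := by
  classical
  obtain ⟨ρ, β, C, hρ0, hρ1, hβ, hC, hgeo⟩ :=
    exists_abs_integral_chainLaw_sub_le hP hV hγ0 hγ hK hdrift hmin
  have hint : ∀ (g : X → ℝ) x t, Integrable g (chainLaw P x t).toMeasure := fun g x t =>
    PMF.integrable_of_finite_support (finite_support_chainLaw hP x t) g
  have hind0 : ∀ z x, (0 : ℝ) ≤ ({z} : Set X).indicator 1 x := fun z x =>
    Set.indicator_nonneg (fun _ _ => zero_le_one) x
  have hind1 : ∀ z x, ({z} : Set X).indicator 1 x ≤ (1 : ℝ) := fun z x =>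
    Set.indicator_le_self' (fun _ _ => zero_le_one) x
  have hgeo' : ∀ z t x y, |(chainLaw P x t z).toReal - (chainLaw P y t z).toReal| ≤
      C * ρ ^ t * (2 + β * (V x + V y)) := by
    intro z t x y
    have := hgeo (({z} : Set X).indicator 1) (hind0 z) (hind1 z) t x y
    rwa [PMF.integral_indicator_singleton, PMF.integral_indicator_singleton] at this
  -- The law at time `t + 1` from `o` is a mixture of laws at time `t` from the states reached in
  -- one step, so forgetting the start makes the sequence Cauchy.
  have hstep : ∀ z t, |(chainLaw P o t z).toReal - (chainLaw P o (t + 1) z).toReal| ≤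
      C * (∫ y, (2 + β * (V o + V y)) ∂(chainLaw P o 1).toMeasure) * ρ ^ t := by
    intro z t
    have h1 : (chainLaw P o t z).toReal - (chainLaw P o (t + 1) z).toReal =
        ∫ y, ((chainLaw P o t z).toReal - (chainLaw P y t z).toReal)
          ∂(chainLaw P o 1).toMeasure := by
      rw [integral_sub (hint _ _ _) (hint _ _ _)]
      simp only [← PMF.integral_indicator_singleton]
      rw [add_comm t 1, integral_chainLaw_add hP]
      simp
    rw [h1]
    refine (abs_integral_le_integral_abs).trans ?_
    rw [mul_right_comm, ← integral_const_mul]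
    exact integral_mono (hint _ _ _) (hint _ _ _) fun y => hgeo' z t o y
  have hex : ∀ z, ∃ l, Tendsto (fun t => (chainLaw P o t z).toReal) atTop (𝓝 l) := fun z =>
    cauchySeq_tendsto_of_complete (cauchySeq_of_le_geometric ρ _ hρ1 fun t => by
      rw [Real.dist_eq]; exact hstep z t)
  choose l hl using hex
  have hlx : ∀ x z, Tendsto (fun t => (chainLaw P x t z).toReal) atTop (𝓝 (l z)) := by
    intro x z
    have h0 : Tendsto (fun t => C * ρ ^ t * (2 + β * (V x + V o))) atTop (𝓝 0) := by
      have := ((tendsto_pow_atTop_nhds_zero_of_lt_one hρ0.le hρ1).const_mul C).mul_const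
        (2 + β * (V x + V o))
      simpa using this
    have h1 := (squeeze_zero_norm (fun t => hgeo' z t x o) h0).add (hl z)
    simpa using h1
  have hl0 : ∀ z, 0 ≤ l z := fun z => ge_of_tendsto' (hl z) fun t => ENNReal.toReal_nonneg
  set p : X → ENNReal := fun z => ENNReal.ofReal (l z) with hp
  have hpx : ∀ x z, Tendsto (fun t => chainLaw P x t z) atTop (𝓝 (p z)) := by
    intro x z
    have := (ENNReal.continuous_ofReal.tendsto _).comp (hlx x z)
    refine this.congr fun t => ?_
    exact ENNReal.ofReal_toReal ((chainLaw P x t).apply_ne_top z)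
  set M : ℝ := V o + K / (1 - γ) with hM
  have h1γ : 0 < 1 - γ := by linarith
  have hM0 : 0 ≤ M := by have := hV o; positivity
  have hVM : ∀ t, ∫ y, V y ∂(chainLaw P o t).toMeasure ≤ M := by
    intro t
    refine (integral_chainLaw_le_of_drift hP hγ0 hγ hK hdrift o t).trans ?_
    have := mul_le_mul_of_nonneg_right (pow_le_one₀ hγ0 hγ.le : γ ^ t ≤ 1) (hV o)
    linarith
  have hsum_le : ∑' z, p z ≤ 1 := by
    rw [ENNReal.tsum_eq_iSup_sum]
    refine iSup_le fun F => ?_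
    refine le_of_tendsto' (tendsto_finsetSum F fun z _ => hpx o z) fun t => ?_
    exact (ENNReal.sum_le_tsum F).trans (chainLaw P o t).tsum_coe.le
  -- Tightness: by Markov's inequality, mass at least `1 - M / R` stays in the finite set where `V ≤
  -- R`, so no mass escapes in the limit.
  have hmass : ∀ R : ℝ, 0 < R → ENNReal.ofReal (1 - M / R) ≤ ∑' z, p z := by
    intro R hR
    set F := (hVfin R).toFinset with hF
    have h1 : ∀ t, 1 - M / R ≤ ∑ z ∈ F, (chainLaw P o t z).toReal := by
      intro t
      have h2 : ∑ z ∈ F, (chainLaw P o t z).toReal =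
          ∫ x, ∑ z ∈ F, ({z} : Set X).indicator 1 x ∂(chainLaw P o t).toMeasure := by
        rw [integral_finsetSum _ fun z _ => hint _ _ _]
        simp only [PMF.integral_indicator_singleton]
      have h3 : ∫ x, (1 - V x / R) ∂(chainLaw P o t).toMeasure ≤
          ∫ x, ∑ z ∈ F, ({z} : Set X).indicator 1 x ∂(chainLaw P o t).toMeasure := by
        refine integral_mono (hint _ _ _) (hint _ _ _) fun x => ?_
        by_cases hx : x ∈ F
        · have h4 : ({x} : Set X).indicator (1 : X → ℝ) x ≤ ∑ z ∈ F, ({z} : Set X).indicator 1 x :=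
            Finset.single_le_sum (f := fun z => ({z} : Set X).indicator (1 : X → ℝ) x)
              (fun z _ => hind0 z x) hx
          have h5 : 0 ≤ V x / R := div_nonneg (hV x) hR.le
          simp only [Set.mem_singleton_iff, Set.indicator_of_mem, Pi.one_apply] at h4
          show 1 - V x / R ≤ _
          linarith
        · have h4 : R < V x := by
            simpa [hF] using hx
          have h5 : 1 ≤ V x / R := (one_le_div hR).2 h4.le
          exact (by linarith : 1 - V x / R ≤ 0).trans (Finset.sum_nonneg fun z _ => hind0 z x)
      rw [h2]
      refine le_trans ?_ h3
      rw [integral_sub (hint _ _ _) (hint _ _ _), integral_div]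
      have := div_le_div_of_nonneg_right (hVM t) hR.le
      simp only [integral_const, probReal_univ, smul_eq_mul, mul_one]
      linarith
    have h2 : 1 - M / R ≤ ∑ z ∈ F, l z :=
      ge_of_tendsto' (tendsto_finsetSum F fun z _ => hl z) h1
    refine (ENNReal.ofReal_le_ofReal h2).trans ?_
    rw [ENNReal.ofReal_sum_of_nonneg fun z _ => hl0 z]
    exact ENNReal.sum_le_tsum F
  have hsum : ∑' z, p z = 1 := by
    refine le_antisymm hsum_le ?_
    have h1 : Tendsto (fun k : ℕ => ENNReal.ofReal (1 - M / ((k : ℝ) + 1))) atTop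
        (𝓝 (ENNReal.ofReal (1 - M * 0))) := by
      refine (ENNReal.continuous_ofReal.tendsto _).comp (tendsto_const_nhds.sub ?_)
      exact (tendsto_one_div_add_atTop_nhds_zero_nat.const_mul M).congr fun k => mul_one_div M _
    rw [mul_zero, sub_zero, ENNReal.ofReal_one] at h1
    exact le_of_tendsto' h1 fun k => hmass _ (by positivity)
  set Q : PMF X := ⟨p, hsum ▸ ENNReal.summable.hasSum⟩ with hQ
  have hQp : ∀ z, Q z = p z := fun z => rfl
  refine ⟨Q, ?_, ?_, ?_, ?_⟩
  -- Fatou only gives `Q.bind P ≤ Q` pointwise; equality follows because both sides have mass one.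
  · refine PMF.eq_of_forall_le fun z => ?_
    rw [PMF.bind_apply, ENNReal.tsum_eq_iSup_sum]
    refine iSup_le fun F => ?_
    refine le_of_tendsto_of_tendsto' (tendsto_finsetSum F fun x _ =>
      ENNReal.Tendsto.mul_const (hpx o x) (Or.inr ((P x).apply_ne_top z)))
      ((tendsto_add_atTop_iff_nat 1).2 (hpx o z)) fun t => ?_
    rw [chainLaw, PMF.bind_apply]
    exact ENNReal.sum_le_tsum F
  · rw [← lintegral_ofReal_ne_top_iff_integrable .of_discrete (ae_of_all _ hV)]
    refine ne_top_of_le_ne_top (ENNReal.ofReal_ne_top (r := M)) ?_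
    rw [lintegral_countable']
    simp only [PMF.toMeasure_apply_singleton _ _ MeasurableSet.of_discrete]
    rw [ENNReal.tsum_eq_iSup_sum]
    refine iSup_le fun F => ?_
    have h1 : ∑ z ∈ F, V z * l z ≤ M :=
      le_of_tendsto' (tendsto_finsetSum F fun z _ => (hl z).const_mul (V z)) fun t =>
        (sum_mul_toReal_le_integral (hint V o t) hV F).trans (hVM t)
    refine le_trans (le_of_eq ?_) (ENNReal.ofReal_le_ofReal h1)
    rw [ENNReal.ofReal_sum_of_nonneg fun z _ => mul_nonneg (hV z) (hl0 z)]
    exact Finset.sum_congr rfl fun z _ => (ENNReal.ofReal_mul (hV z)).symm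
  · exact hpx
  · intro Q' hQ'
    ext z
    -- A stationary law is the mixture of the laws at time `t` over its own starting states, all of
    -- which converge to `l z`.
    have h1 : ∀ t, (Q' z).toReal = ∫ x, (chainLaw P x t z).toReal ∂Q'.toMeasure := by
      intro t
      conv_lhs => rw [← bind_chainLaw_of_stationary hQ' t]
      simp only [← PMF.integral_indicator_singleton]
      refine PMF.integral_bind ?_
      exact (integrable_const (1 : ℝ)).indicator MeasurableSet.of_discrete
    have h2 : Tendsto (fun t => ∫ x, (chainLaw P x t z).toReal ∂Q'.toMeasure) atTop
        (𝓝 (∫ _, l z ∂Q'.toMeasure)) := by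
      refine tendsto_integral_of_dominated_convergence (fun _ => 1)
        (fun t => .of_discrete) (integrable_const _) (fun t => ae_of_all _ fun x => ?_)
        (ae_of_all _ fun x => hlx x z)
      rw [Real.norm_of_nonneg ENNReal.toReal_nonneg]
      exact ENNReal.toReal_le_of_le_ofReal zero_le_one (by simpa using PMF.coe_le_one _ z)
    simp only [← h1] at h2
    have h3 := tendsto_nhds_unique tendsto_const_nhds h2
    simp only [integral_const, probReal_univ, smul_eq_mul, one_mul] at h3
    rw [hQp, hp, ← ENNReal.ofReal_toReal (Q'.apply_ne_top z), h3]

end Ergodic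

/-! ### The cone of collapsed states and the form seeing row and column sums. -/

section Geometry

variable {n : ℕ}

/-- The Frobenius inner product. -/
def frob (x y : Fin n → Fin n → ℝ) : ℝ := ∑ i, ∑ j, x i j * y i j

/-- The sum of all entries. -/
def entrySum (x : Fin n → Fin n → ℝ) : ℝ := ∑ i, ∑ j, x i j

lemma frob_comm (x y : Fin n → Fin n → ℝ) : frob x y = frob y x := by
  simp only [frob, mul_comm]

lemma frob_add_left (x y z : Fin n → Fin n → ℝ) : frob (x + y) z = frob x z + frob y z := by
  simp [frob, add_mul, Finset.sum_add_distrib]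

lemma frob_sub_left (x y z : Fin n → Fin n → ℝ) : frob (x - y) z = frob x z - frob y z := by
  simp [frob, sub_mul, Finset.sum_sub_distrib]

lemma frob_smul_left (c : ℝ) (x z : Fin n → Fin n → ℝ) : frob (c • x) z = c * frob x z := by
  simp [frob, mul_assoc, Finset.mul_sum]

lemma frob_add_right (x y z : Fin n → Fin n → ℝ) : frob x (y + z) = frob x y + frob x z := by
  rw [frob_comm, frob_add_left, frob_comm y, frob_comm z]

lemma frob_sub_right (x y z : Fin n → Fin n → ℝ) : frob x (y - z) = frob x y - frob x z := by
  rw [frob_comm, frob_sub_left, frob_comm y, frob_comm z]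

lemma frob_smul_right (c : ℝ) (x z : Fin n → Fin n → ℝ) : frob x (c • z) = c * frob x z := by
  rw [frob_comm, frob_smul_left, frob_comm]

lemma frob_self_nonneg (x : Fin n → Fin n → ℝ) : 0 ≤ frob x x :=
  Finset.sum_nonneg fun _ _ => Finset.sum_nonneg fun _ _ => mul_self_nonneg _

lemma sq_le_frob_self (x : Fin n → Fin n → ℝ) (i j : Fin n) : x i j ^ 2 ≤ frob x x := by
  rw [sq]
  refine le_trans ?_ (Finset.single_le_sum (f := fun i => ∑ j, x i j * x i j)
    (fun i _ => Finset.sum_nonneg fun j _ => mul_self_nonneg _) (Finset.mem_univ i))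
  exact Finset.single_le_sum (f := fun j => x i j * x i j)
    (fun j _ => mul_self_nonneg _) (Finset.mem_univ j)

lemma abs_le_sqrt_frob_self (x : Fin n → Fin n → ℝ) (i j : Fin n) :
    |x i j| ≤ √(frob x x) := Real.abs_le_sqrt (sq_le_frob_self x i j)

lemma frob_mono_right {x y z : Fin n → Fin n → ℝ} (hx : ∀ i j, 0 ≤ x i j)
    (h : ∀ i j, y i j ≤ z i j) : frob x y ≤ frob x z :=
  Finset.sum_le_sum fun i _ => Finset.sum_le_sum fun j _ =>
    mul_le_mul_of_nonneg_left (h i j) (hx i j)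

lemma abs_frob_le {x y : Fin n → Fin n → ℝ} {c : ℝ} (hx : ∀ i j, |x i j| ≤ c)
    (hy : ∀ i j, 0 ≤ y i j) : |frob x y| ≤ c * entrySum y := by
  rw [entrySum, Finset.mul_sum]
  refine (Finset.abs_sum_le_sum_abs _ _).trans (Finset.sum_le_sum fun i _ => ?_)
  rw [Finset.mul_sum]
  refine (Finset.abs_sum_le_sum_abs _ _).trans (Finset.sum_le_sum fun j _ => ?_)
  rw [abs_mul, abs_of_nonneg (hy i j)]
  exact mul_le_mul_of_nonneg_right (hx i j) (hy i j)

/-- The cone of nonnegative matrices of the form `x i j = w i + v j`. -/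
def collapseCone (n : ℕ) : Set (Fin n → Fin n → ℝ) :=
  {x | (∀ i j k l, x i j + x k l = x i l + x k j) ∧ ∀ i j, 0 ≤ x i j}

lemma exists_eq_add_of_mem_collapseCone {x : Fin n → Fin n → ℝ} (hx : x ∈ collapseCone n) :
    ∃ w v : Fin n → ℝ, ∀ i j, x i j = w i + v j := by
  rcases isEmpty_or_nonempty (Fin n) with h | ⟨⟨o⟩⟩
  · exact ⟨0, 0, fun i => (h.false i).elim⟩
  · exact ⟨fun i => x i o, fun j => x o j - x o o, fun i j => by
      have := hx.1 i j o o
      linarith⟩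

lemma row_mem_collapseCone (i₀ : Fin n) :
    (fun i _ => if i = i₀ then (1 : ℝ) else 0) ∈ collapseCone n :=
  ⟨fun _ _ _ _ => rfl, fun i _ => by dsimp only; split_ifs <;> norm_num⟩

lemma col_mem_collapseCone (j₀ : Fin n) :
    (fun _ j => if j = j₀ then (1 : ℝ) else 0) ∈ collapseCone n :=
  ⟨fun _ _ _ _ => add_comm _ _, fun _ j => by dsimp only; split_ifs <;> norm_num⟩

/-- Moreau's decomposition: the Euclidean projection onto a closed convex cone leaves a remainder
that is orthogonal to the projection and lies in the polar cone. -/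
lemma exists_collapseCone_proj (x : Fin n → Fin n → ℝ) :
    ∃ k ∈ collapseCone n, frob (x - k) k = 0 ∧ ∀ y ∈ collapseCone n, frob (x - k) y ≤ 0 := by
  let m : EuclideanSpace ℝ (Fin n × Fin n) → Fin n → Fin n → ℝ := fun e i j => e (i, j)
  let K : Set (EuclideanSpace ℝ (Fin n × Fin n)) := m ⁻¹' collapseCone n
  have hcone : ∀ x ∈ collapseCone n, ∀ y ∈ collapseCone n, ∀ a b : ℝ, 0 ≤ a → 0 ≤ b →
      (fun i j => a * x i j + b * y i j) ∈ collapseCone n := by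
    rintro x ⟨hx1, hx2⟩ y ⟨hy1, hy2⟩ a b ha hb
    refine ⟨fun i j k l => ?_, fun i j => ?_⟩
    · linear_combination a * hx1 i j k l + b * hy1 i j k l
    · have := hx2 i j; have := hy2 i j; positivity
  have hclosed : IsClosed K := by
    have hc : ∀ i j, Continuous fun e : EuclideanSpace ℝ (Fin n × Fin n) => m e i j := fun i j => by
      show Continuous fun e : EuclideanSpace ℝ (Fin n × Fin n) => e (i, j)
      fun_prop
    have : K = (⋂ i, ⋂ j, ⋂ k, ⋂ l, {e | m e i j + m e k l = m e i l + m e k j}) ∩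
        ⋂ i, ⋂ j, {e | 0 ≤ m e i j} := by
      ext e
      simp [K, collapseCone]
    rw [this]
    refine IsClosed.inter ?_ ?_
    · exact isClosed_iInter fun i => isClosed_iInter fun j => isClosed_iInter fun k =>
        isClosed_iInter fun l => isClosed_eq ((hc _ _).add (hc _ _)) ((hc _ _).add (hc _ _))
    · exact isClosed_iInter fun i => isClosed_iInter fun j => isClosed_le continuous_const (hc _ _)
  have hconv : Convex ℝ K := fun e he f hf a b ha hb _ => by
    have := hcone _ he _ hf a b ha hb
    exact this
  let u : EuclideanSpace ℝ (Fin n × Fin n) := WithLp.toLp 2 fun p => x p.1 p.2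
  have hne : K.Nonempty := ⟨0, by simp [K, m, collapseCone]⟩
  obtain ⟨v, hv, hmin⟩ := exists_norm_eq_iInf_of_complete_convex hne hclosed.isComplete hconv u
  rw [norm_eq_iInf_iff_real_inner_le_zero hconv hv] at hmin
  have hin : ∀ z ∈ collapseCone n, frob (x - m v) (z - m v) ≤ 0 := by
    intro z hz
    have h1 := hmin (WithLp.toLp 2 fun p => z p.1 p.2) hz
    refine le_trans (le_of_eq ?_) h1
    rw [PiLp.inner_apply, Fintype.sum_prod_type, frob]
    refine Finset.sum_congr rfl fun i _ => Finset.sum_congr rfl fun j _ => ?_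
    simp only [Pi.sub_apply, PiLp.sub_apply, RCLike.inner_apply, conj_trivial, u, m]
    rw [mul_comm]
  have h0 : frob (x - m v) (m v) = 0 := by
    -- The variational inequality at `2k` and at `0`, where `k` is the projection, gives the two
    -- signs of the orthogonality.
    have h2 := hin _ (hcone _ hv _ hv 1 1 zero_le_one zero_le_one)
    have h3 := hin _ (hcone _ hv _ hv 0 0 le_rfl le_rfl)
    have e2 : (fun i j => 1 * m v i j + 1 * m v i j) - m v = m v := by
      ext i j; simp
    have e3 : (fun i j => 0 * m v i j + 0 * m v i j) - m v = (-1 : ℝ) • m v := by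
      ext i j; simp
    rw [e2] at h2
    rw [e3, frob_smul_right] at h3
    linarith
  refine ⟨m v, hv, h0, fun y hy => ?_⟩
  have := hin y hy
  rw [frob_sub_right, h0] at this
  linarith

/-- A projection onto `collapseCone n`. -/
def coneProj (x : Fin n → Fin n → ℝ) : Fin n → Fin n → ℝ := (exists_collapseCone_proj x).choose

/-- The component of `x` orthogonal to its projection onto `collapseCone n`. -/
def conePerp (x : Fin n → Fin n → ℝ) : Fin n → Fin n → ℝ := x - coneProj x

/-- The distance of `x` from `collapseCone n`. -/
def coneDist (x : Fin n → Fin n → ℝ) : ℝ := √(frob (conePerp x) (conePerp x))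

lemma coneProj_mem (x : Fin n → Fin n → ℝ) : coneProj x ∈ collapseCone n :=
  (exists_collapseCone_proj x).choose_spec.1

lemma frob_conePerp_coneProj (x : Fin n → Fin n → ℝ) : frob (conePerp x) (coneProj x) = 0 :=
  (exists_collapseCone_proj x).choose_spec.2.1

lemma frob_conePerp_le_zero (x : Fin n → Fin n → ℝ) {y : Fin n → Fin n → ℝ}
    (hy : y ∈ collapseCone n) : frob (conePerp x) y ≤ 0 :=
  (exists_collapseCone_proj x).choose_spec.2.2 y hy

lemma coneProj_add_conePerp (x : Fin n → Fin n → ℝ) : coneProj x + conePerp x = x := by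
  simp [conePerp]

lemma coneDist_nonneg (x : Fin n → Fin n → ℝ) : 0 ≤ coneDist x := Real.sqrt_nonneg _

lemma coneDist_sq (x : Fin n → Fin n → ℝ) :
    coneDist x ^ 2 = frob (conePerp x) (conePerp x) := Real.sq_sqrt (frob_self_nonneg _)

lemma abs_conePerp_le (x : Fin n → Fin n → ℝ) (i j : Fin n) : |conePerp x i j| ≤ coneDist x :=
  abs_le_sqrt_frob_self _ i j

lemma frob_conePerp_self (x : Fin n → Fin n → ℝ) : frob x (conePerp x) = coneDist x ^ 2 := by
  have h := frob_add_left (coneProj x) (conePerp x) (conePerp x)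
  rwa [coneProj_add_conePerp, frob_comm (coneProj x), frob_conePerp_coneProj, ← coneDist_sq,
    zero_add] at h

lemma coneDist_sq_le (x : Fin n → Fin n → ℝ) {y : Fin n → Fin n → ℝ} (hy : y ∈ collapseCone n) :
    coneDist x ^ 2 ≤ frob (x - y) (x - y) := by
  have h1 : x - y = conePerp x + (coneProj x - y) := by
    simp [conePerp]
  have h2 := frob_conePerp_le_zero x hy
  have h3 := frob_self_nonneg (coneProj x - y)
  rw [h1, frob_add_left, frob_add_right, frob_add_right, frob_comm (coneProj x - y) (conePerp x),
    frob_sub_right (conePerp x), frob_conePerp_coneProj, coneDist_sq]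
  linarith

lemma coneDist_sq_le_frob_self (x : Fin n → Fin n → ℝ) : coneDist x ^ 2 ≤ frob x x := by
  simpa using coneDist_sq_le x (y := 0) ⟨by simp, by simp⟩

/-- The indicator of a row lies in the cone, and the remainder lies in its polar. -/
lemma rowSum_conePerp_le_zero (x : Fin n → Fin n → ℝ) (i : Fin n) : ∑ j, conePerp x i j ≤ 0 := by
  have := frob_conePerp_le_zero x (row_mem_collapseCone i)
  simpa [frob, ← Finset.sum_mul] using this

lemma colSum_conePerp_le_zero (x : Fin n → Fin n → ℝ) (j : Fin n) : ∑ i, conePerp x i j ≤ 0 := by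
  have := frob_conePerp_le_zero x (col_mem_collapseCone j)
  simpa [frob] using this

/-- Matrices in the span of `collapseCone n` only see row and column sums. -/
lemma frob_eq_of_mem_collapseCone {k y z : Fin n → Fin n → ℝ} (hk : k ∈ collapseCone n)
    (hrow : ∀ i, ∑ j, y i j = ∑ j, z i j) (hcol : ∀ j, ∑ i, y i j = ∑ i, z i j) :
    frob k y = frob k z := by
  obtain ⟨w, v, h⟩ := exists_eq_add_of_mem_collapseCone hk
  have : ∀ y : Fin n → Fin n → ℝ,
      frob k y = ∑ i, w i * ∑ j, y i j + ∑ j, v j * ∑ i, y i j := by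
    intro y
    simp only [frob, h, add_mul, Finset.sum_add_distrib, Finset.mul_sum]
    congr 1
    exact Finset.sum_comm
  rw [this y, this z]
  simp only [hrow, hcol]

/-- A matrix with nonpositive row and column sums is dominated by one with zero row and column
sums. -/
lemma exists_ge_rowSum_colSum_eq_zero {d : Fin n → Fin n → ℝ} (hrow : ∀ i, ∑ j, d i j ≤ 0)
    (hcol : ∀ j, ∑ i, d i j ≤ 0) :
    ∃ e : Fin n → Fin n → ℝ, (∀ i j, d i j ≤ e i j) ∧ (∀ i, ∑ j, e i j = 0) ∧
      ∀ j, ∑ i, e i j = 0 := by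
  set T := ∑ i, ∑ j, d i j with hT
  have hT' : ∑ j, ∑ i, d i j = T := Finset.sum_comm
  have hT0 : T ≤ 0 := Finset.sum_nonpos fun i _ => hrow i
  -- The correction is the rank-one matrix with the missing row and column sums. It is nonnegative
  -- since those of `d` are nonpositive. If the total is zero, all row and column sums vanish
  -- already and division by zero yields no correction.
  refine ⟨fun i j => d i j + (∑ l, d i l) * (∑ l, d l j) / (-T), fun i j => ?_, fun i => ?_,
    fun j => ?_⟩
  · have := div_nonneg (mul_nonneg_of_nonpos_of_nonpos (hrow i) (hcol j)) (neg_nonneg.2 hT0)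
    linarith
  · rw [Finset.sum_add_distrib, ← Finset.sum_div, ← Finset.mul_sum, hT']
    by_cases h : T = 0
    · rw [h, neg_zero, div_zero, add_zero]
      exact (Finset.sum_eq_zero_iff_of_nonpos fun i _ => hrow i).1 (hT.symm.trans h) i
        (Finset.mem_univ i)
    · field_simp
      ring
  · rw [Finset.sum_add_distrib, ← Finset.sum_div, ← Finset.sum_mul, ← hT]
    by_cases h : T = 0
    · rw [h, neg_zero, div_zero, add_zero]
      exact (Finset.sum_eq_zero_iff_of_nonpos fun i _ => hcol i).1 (hT'.trans h) j
        (Finset.mem_univ j)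
    · field_simp
      ring

/-- The bilinear form of the orthogonal projection onto the matrices `w i + v j`. -/
def marginForm (x y : Fin n → Fin n → ℝ) : ℝ :=
  (∑ i, (∑ j, x i j) * ∑ j, y i j) / n + (∑ j, (∑ i, x i j) * ∑ i, y i j) / n -
    entrySum x * entrySum y / n ^ 2

lemma marginForm_comm (x y : Fin n → Fin n → ℝ) : marginForm x y = marginForm y x := by
  simp only [marginForm, mul_comm]

lemma marginForm_add_left (x y z : Fin n → Fin n → ℝ) :
    marginForm (x + y) z = marginForm x z + marginForm y z := by
  simp only [marginForm, entrySum, Pi.add_apply, Finset.sum_add_distrib, add_mul, add_div]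
  ring

lemma marginForm_eq_sum (x y : Fin n → Fin n → ℝ) :
    marginForm x y = frob
      (fun i j => (∑ l, x i l) / n + (∑ l, x l j) / n - entrySum x / n ^ 2) y := by
  have h1 : (∑ i, (∑ j, x i j) * ∑ j, y i j) / n = ∑ i, ∑ j, (∑ l, x i l) / n * y i j := by
    simp only [Finset.sum_div, Finset.mul_sum, mul_div_right_comm]
  have h2 : (∑ j, (∑ i, x i j) * ∑ i, y i j) / n = ∑ i, ∑ j, (∑ l, x l j) / n * y i j := by
    rw [Finset.sum_comm (f := fun i j => (∑ l, x l j) / n * y i j)]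
    simp only [Finset.sum_div, Finset.mul_sum, mul_div_right_comm]
  have h3 : entrySum x * entrySum y / n ^ 2 = ∑ i, ∑ j, entrySum x / n ^ 2 * y i j := by
    simp only [← Finset.mul_sum]
    rw [← entrySum, mul_div_right_comm]
  rw [marginForm, h1, h2, h3]
  simp only [frob, sub_mul, add_mul, Finset.sum_add_distrib, Finset.sum_sub_distrib]

/-- Pairing through the projection is the plain pairing when one argument is already of the form `w
i + v j`. -/
lemma marginForm_eq_frob (hn : 0 < n) {k : Fin n → Fin n → ℝ} (hk : k ∈ collapseCone n)
    (y : Fin n → Fin n → ℝ) : marginForm k y = frob k y := by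
  obtain ⟨w, v, h⟩ := exists_eq_add_of_mem_collapseCone hk
  have hn' : (n : ℝ) ≠ 0 := by positivity
  rw [marginForm_eq_sum]
  congr 1
  ext i j
  simp only [entrySum, h, Finset.sum_add_distrib, Finset.sum_const, Finset.card_univ,
    Fintype.card_fin, nsmul_eq_mul, ← Finset.mul_sum]
  field_simp
  ring

/-- The projection has entries row mean plus column mean minus overall mean; each of these three
averages is at most `c` in absolute value. -/
lemma abs_marginForm_le (hn : 0 < n) {x y : Fin n → Fin n → ℝ} {c : ℝ}
    (hx : ∀ i j, |x i j| ≤ c) (hy : ∀ i j, 0 ≤ y i j) :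
    |marginForm x y| ≤ 3 * c * entrySum y := by
  have hn' : (0 : ℝ) < n := by exact_mod_cast hn
  rw [marginForm_eq_sum]
  refine abs_frob_le (fun i j => ?_) hy
  have h1 : |(∑ l, x i l) / n| ≤ c := by
    rw [abs_div, abs_of_pos hn', div_le_iff₀ hn']
    refine (Finset.abs_sum_le_sum_abs _ _).trans ((Finset.sum_le_sum fun l _ => hx i l).trans ?_)
    simp [mul_comm]
  have h2 : |(∑ l, x l j) / n| ≤ c := by
    rw [abs_div, abs_of_pos hn', div_le_iff₀ hn']
    refine (Finset.abs_sum_le_sum_abs _ _).trans ((Finset.sum_le_sum fun l _ => hx l j).trans ?_)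
    simp [mul_comm]
  have h3 : |entrySum x / n ^ 2| ≤ c := by
    rw [abs_div, abs_of_pos (by positivity : (0 : ℝ) < (n : ℝ) ^ 2), div_le_iff₀ (by positivity)]
    refine (Finset.abs_sum_le_sum_abs _ _).trans ((Finset.sum_le_sum fun i _ =>
      (Finset.abs_sum_le_sum_abs _ _).trans (Finset.sum_le_sum fun l _ => hx i l)).trans ?_)
    simp only [Finset.sum_const, Finset.card_univ, Fintype.card_fin, nsmul_eq_mul]
    exact le_of_eq (by ring)
  rw [abs_le] at *
  constructor <;> linarith [h1.1, h1.2, h2.1, h2.2, h3.1, h3.2]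

/-- Unused service `u` on empty queues changes the quadratic form `marginForm` only by the
distance from the cone. -/
lemma abs_marginForm_sub_le (hn : 0 < n) {x u : Fin n → Fin n → ℝ} (hu0 : ∀ i j, 0 ≤ u i j)
    (hu1 : ∀ i j, u i j ≤ 1) (hxu : ∀ i j, x i j * u i j = 0) :
    |marginForm x x - marginForm (x - u) (x - u)| ≤ (8 * coneDist x + 3) * entrySum u := by
  have hdiff : marginForm x x - marginForm (x - u) (x - u) =
      2 * marginForm x u - marginForm u u := by
    have h1 : marginForm x x = marginForm (x - u) (x - u) + 2 * marginForm (x - u) u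
        + marginForm u u := by
      conv_lhs => rw [← sub_add_cancel x u]
      rw [marginForm_add_left, marginForm_comm _ (x - u + u), marginForm_comm _ (x - u + u),
        marginForm_add_left, marginForm_add_left, marginForm_comm u (x - u)]
      ring
    have h2 : marginForm x u = marginForm (x - u) u + marginForm u u := by
      conv_lhs => rw [← sub_add_cancel x u]
      rw [marginForm_add_left]
    linarith
  have hxu0 : frob x u = 0 := by simp [frob, hxu]
  -- Orthogonality of `x` and `u` trades the possibly large cone part of `x` for minus its
  -- remainder, so only quantities of the size of `coneDist x` are left.
  have hxform : marginForm x u = marginForm (conePerp x) u - frob (conePerp x) u := by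
    have h1 : marginForm x u = frob (coneProj x) u + marginForm (conePerp x) u := by
      have h := marginForm_add_left (coneProj x) (conePerp x) u
      rwa [coneProj_add_conePerp, marginForm_eq_frob hn (coneProj_mem x)] at h
    have h2 : frob x u = frob (coneProj x) u + frob (conePerp x) u := by
      rw [← frob_add_left, coneProj_add_conePerp]
    linarith
  have h1 := abs_marginForm_le hn (abs_conePerp_le x) hu0
  have h2 := abs_frob_le (abs_conePerp_le x) hu0
  have h3 := abs_marginForm_le hn (x := u) (c := 1)
    (fun i j => by rw [abs_of_nonneg (hu0 i j)]; exact hu1 i j) hu0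
  rw [hdiff, hxform]
  rw [abs_le] at *
  constructor <;> linarith [h1.1, h1.2, h2.1, h2.2, h3.1, h3.2]

end Geometry

/-! ### MaxWeight schedules and unused service. -/

section Switch

variable {n : ℕ}

/-- A vector of natural numbers as a real matrix. -/
def realState (q : SwitchState n) : Fin n → Fin n → ℝ := fun i j => q i j

/-- The service matrix of a schedule. -/
def serviceMatrix (τ : Equiv.Perm (Fin n)) : Fin n → Fin n → ℝ := fun i j => switchService τ i j

lemma realState_nonneg (q : SwitchState n) (i j : Fin n) : 0 ≤ realState q i j := Nat.cast_nonneg _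

lemma serviceMatrix_nonneg (τ : Equiv.Perm (Fin n)) (i j : Fin n) : 0 ≤ serviceMatrix τ i j :=
  Nat.cast_nonneg _

lemma rowSum_serviceMatrix (τ : Equiv.Perm (Fin n)) (i : Fin n) : ∑ j, serviceMatrix τ i j = 1 := by
  simp [serviceMatrix, switchService]

lemma colSum_serviceMatrix (τ : Equiv.Perm (Fin n)) (j : Fin n) : ∑ i, serviceMatrix τ i j = 1 := by
  simp only [serviceMatrix, switchService, Nat.cast_ite, Nat.cast_one, Nat.cast_zero]
  rw [Finset.sum_eq_single (τ.symm j)]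
  · simp
  · intro i _ hi
    have : τ i ≠ j := fun h => hi (by rw [← h, Equiv.symm_apply_apply])
    simp [this]
  · simp

lemma permMatrix_apply_eq_serviceMatrix (τ : Equiv.Perm (Fin n)) (i j : Fin n) :
    τ.permMatrix ℝ i j = serviceMatrix τ i j := by
  simp [Equiv.Perm.permMatrix, PEquiv.toMatrix_apply, serviceMatrix, switchService, eq_comm]

lemma cast_scheduleWeight (q : SwitchState n) (τ : Equiv.Perm (Fin n)) :
    (scheduleWeight q τ : ℝ) = frob (realState q) (serviceMatrix τ) := by
  simp [scheduleWeight, frob, realState, serviceMatrix]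

lemma entrySum_serviceMatrix (τ : Equiv.Perm (Fin n)) : entrySum (serviceMatrix τ) = n := by
  simp [entrySum, rowSum_serviceMatrix]

variable {S : SwitchState n → PMF (Equiv.Perm (Fin n))}

/-- A MaxWeight schedule has at least the weight of any doubly stochastic matrix. -/
lemma frob_le_of_isMaxWeight (hS : IsMaxWeight S) {q : SwitchState n} {τ : Equiv.Perm (Fin n)}
    (hτ : τ ∈ (S q).support) {M : Matrix (Fin n) (Fin n) ℝ} (hM : M ∈ doublyStochastic ℝ (Fin n)) :
    frob (realState q) M ≤ frob (realState q) (serviceMatrix τ) := by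
  obtain ⟨w, hw0, hw1, hwM⟩ := exists_eq_sum_perm_of_mem_doublyStochastic hM
  have h1 : frob (realState q) M = ∑ π, w π * frob (realState q) (serviceMatrix π) := by
    rw [← hwM]
    simp only [frob, Matrix.sum_apply, Matrix.smul_apply, permMatrix_apply_eq_serviceMatrix,
      smul_eq_mul, Finset.mul_sum]
    rw [Finset.sum_comm]
    rw [Finset.sum_congr rfl fun j _ => Finset.sum_comm, Finset.sum_comm]
    refine Finset.sum_congr rfl fun π _ => ?_
    rw [Finset.sum_comm]
    exact Finset.sum_congr rfl fun i _ => Finset.sum_congr rfl fun j _ => by ring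
  have h2 : ∀ π, w π * frob (realState q) (serviceMatrix π) ≤
      w π * frob (realState q) (serviceMatrix τ) := fun π => by
    refine mul_le_mul_of_nonneg_left ?_ (hw0 π)
    rw [← cast_scheduleWeight, ← cast_scheduleWeight]
    exact_mod_cast hS q τ hτ π
  rw [h1]
  refine (Finset.sum_le_sum fun π _ => h2 π).trans ?_
  rw [← Finset.sum_mul, hw1, one_mul]

/-- The weight of a MaxWeight schedule exceeds that of an interior doubly stochastic matrix by a
multiple of the distance from the cone. -/
lemma frob_add_coneDist_le_of_isMaxWeight (hS : IsMaxWeight S) {q : SwitchState n}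
    {τ : Equiv.Perm (Fin n)} (hτ : τ ∈ (S q).support) {ν : Matrix (Fin n) (Fin n) ℝ}
    (hν : ν ∈ doublyStochastic ℝ (Fin n)) {δ : ℝ} (hδ : 0 ≤ δ) (hδν : ∀ i j, δ ≤ ν i j) :
    frob (realState q) ν + δ * coneDist (realState q) ≤
      frob (realState q) (serviceMatrix τ) := by
  set x := realState q with hx
  rcases (coneDist_nonneg x).eq_or_lt with h0 | hpos
  · rw [← h0, mul_zero, add_zero]
    exact frob_le_of_isMaxWeight hS hτ hν
  obtain ⟨e, hde, hrow, hcol⟩ := exists_ge_rowSum_colSum_eq_zero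
    (rowSum_conePerp_le_zero x) (colSum_conePerp_le_zero x)
  set c := δ / coneDist x with hc
  have hc0 : 0 ≤ c := div_nonneg hδ hpos.le
  rw [mem_doublyStochastic_iff_sum] at hν
  -- Entries of `e` are at least `-coneDist x`, so the tilt lowers no entry of `ν` by more than `δ`.
  -- Zero row and column sums of `e` keep the margins equal to one.
  have hM : Matrix.of (fun i j => ν i j + c * e i j) ∈
      doublyStochastic ℝ (Fin n) := by
    rw [mem_doublyStochastic_iff_sum]
    simp only [Matrix.of_apply]
    refine ⟨fun i j => ?_, fun i => ?_, fun j => ?_⟩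
    · have h1 := (abs_le.1 (abs_conePerp_le x i j)).1.trans (hde i j)
      have h2 : c * (-coneDist x) ≤ c * e i j := mul_le_mul_of_nonneg_left h1 hc0
      have h3 : c * coneDist x = δ := by rw [hc]; field_simp
      have := hδν i j
      linarith
    · rw [Finset.sum_add_distrib, ← Finset.mul_sum, hrow, hν.2.1, mul_zero, add_zero]
    · rw [Finset.sum_add_distrib, ← Finset.mul_sum, hcol, hν.2.2, mul_zero, add_zero]
  refine le_trans ?_ (frob_le_of_isMaxWeight hS hτ hM)
  have h1 : frob x (Matrix.of fun i j => ν i j + c * e i j) = frob x ν + c * frob x e := by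
    simp only [frob, Matrix.of_apply, mul_add, Finset.sum_add_distrib, Finset.mul_sum,
      mul_left_comm]
  have h2 : frob x (conePerp x) ≤ frob x e := frob_mono_right (realState_nonneg q) hde
  rw [frob_conePerp_self] at h2
  have h3 : c * coneDist x ^ 2 = δ * coneDist x := by rw [hc]; field_simp
  rw [← hx, h1, ← h3]
  have := mul_le_mul_of_nonneg_left h2 hc0
  linarith

/-- The service that is offered to empty queues. -/
def unusedService (q a : SwitchState n) (τ : Equiv.Perm (Fin n)) : Fin n → Fin n → ℝ :=
  realState (nextQueue q a τ) - (realState q + realState a - serviceMatrix τ)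

lemma unusedService_cases (q a : SwitchState n) (τ : Equiv.Perm (Fin n)) (i j : Fin n) :
    unusedService q a τ i j = 0 ∨
      unusedService q a τ i j = 1 ∧ q i j = 0 ∧ a i j = 0 ∧ switchService τ i j = 1 := by
  have hs : switchService τ i j = 0 ∨ switchService τ i j = 1 := by
    unfold switchService; split_ifs <;> simp
  simp only [unusedService, Pi.sub_apply, Pi.add_apply, realState, serviceMatrix, nextQueue]
  by_cases h : switchService τ i j ≤ q i j + a i j
  · left
    rw [Nat.cast_sub h]; push_cast; ring
  · right
    have h1 : q i j = 0 := by omega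
    have h2 : a i j = 0 := by omega
    have h3 : switchService τ i j = 1 := by omega
    simp [h1, h2, h3]

lemma unusedService_nonneg (q a : SwitchState n) (τ : Equiv.Perm (Fin n)) (i j : Fin n) :
    0 ≤ unusedService q a τ i j := by
  rcases unusedService_cases q a τ i j with h | h <;> simp [h]

lemma unusedService_le_one (q a : SwitchState n) (τ : Equiv.Perm (Fin n)) (i j : Fin n) :
    unusedService q a τ i j ≤ 1 := by
  rcases unusedService_cases q a τ i j with h | h <;> simp [h]

lemma unusedService_le_serviceMatrix (q a : SwitchState n) (τ : Equiv.Perm (Fin n))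
    (i j : Fin n) : unusedService q a τ i j ≤ serviceMatrix τ i j := by
  rcases unusedService_cases q a τ i j with h | h
  · rw [h]; exact serviceMatrix_nonneg τ i j
  · simp [h, serviceMatrix]

lemma nextQueue_mul_unusedService (q a : SwitchState n) (τ : Equiv.Perm (Fin n)) (i j : Fin n) :
    realState (nextQueue q a τ) i j * unusedService q a τ i j = 0 := by
  rcases unusedService_cases q a τ i j with h | ⟨-, h1, h2, h3⟩
  · rw [h, mul_zero]
  · simp [realState, nextQueue, h1, h2, h3]

lemma realState_nextQueue (q a : SwitchState n) (τ : Equiv.Perm (Fin n)) :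
    realState (nextQueue q a τ) =
      realState q + (realState a - serviceMatrix τ) + unusedService q a τ := by
  rw [unusedService]; abel

lemma entrySum_unusedService_le (q a : SwitchState n) (τ : Equiv.Perm (Fin n)) :
    entrySum (unusedService q a τ) ≤ n := by
  rw [← entrySum_serviceMatrix τ]
  exact Finset.sum_le_sum fun i _ => Finset.sum_le_sum fun j _ =>
    unusedService_le_serviceMatrix q a τ i j

lemma entrySum_unusedService_nonneg (q a : SwitchState n) (τ : Equiv.Perm (Fin n)) :
    0 ≤ entrySum (unusedService q a τ) :=
  Finset.sum_nonneg fun i _ => Finset.sum_nonneg fun j _ => unusedService_nonneg q a τ i j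

lemma entrySum_add (x y : Fin n → Fin n → ℝ) : entrySum (x + y) = entrySum x + entrySum y := by
  simp [entrySum, Finset.sum_add_distrib]

lemma entrySum_sub (x y : Fin n → Fin n → ℝ) : entrySum (x - y) = entrySum x - entrySum y := by
  simp [entrySum, Finset.sum_sub_distrib]

/-- Balance of packets. Under a stationary law with integrable queues the two queue terms cancel, so
the mean unused service is determined by the arrival rates alone. -/
lemma entrySum_unusedService (q a : SwitchState n) (τ : Equiv.Perm (Fin n)) :
    entrySum (unusedService q a τ) = entrySum (realState (nextQueue q a τ)) -
      entrySum (realState q) - entrySum (realState a) + n := by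
  rw [unusedService, entrySum_sub, entrySum_sub, entrySum_add, entrySum_serviceMatrix]
  ring

lemma abs_nextQueue_sub_le {amax : ℕ} {q a : SwitchState n} (ha : ∀ i j, a i j ≤ amax)
    (τ : Equiv.Perm (Fin n)) (i j : Fin n) :
    |(realState (nextQueue q a τ) - realState q) i j| ≤ amax + 1 := by
  have hs : switchService τ i j ≤ 1 := by unfold switchService; split_ifs <;> simp
  have h1 : nextQueue q a τ i j ≤ q i j + amax := by
    have := ha i j; simp only [nextQueue]; omega
  have h2 : q i j ≤ nextQueue q a τ i j + 1 := by simp only [nextQueue]; omega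
  have h1' : (nextQueue q a τ i j : ℝ) ≤ q i j + amax := by exact_mod_cast h1
  have h2' : (q i j : ℝ) ≤ nextQueue q a τ i j + 1 := by exact_mod_cast h2
  have h3 : (0 : ℝ) ≤ amax := Nat.cast_nonneg _
  simp only [Pi.sub_apply, realState]
  rw [abs_le]; constructor <;> linarith

/-- Unused service only decreases the correlation with a matrix that is nonpositive at the empty
queues. -/
lemma frob_nextQueue_sub_le {q a : SwitchState n} (τ : Equiv.Perm (Fin n))
    {d : Fin n → Fin n → ℝ} (hd : ∀ i j, q i j = 0 → d i j ≤ 0) :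
    frob d (realState (nextQueue q a τ) - realState q) ≤
      frob d (realState a - serviceMatrix τ) := by
  rw [realState_nextQueue, add_assoc, add_sub_cancel_left, frob_add_right]
  have : frob d (unusedService q a τ) ≤ 0 := by
    refine Finset.sum_nonpos fun i _ => Finset.sum_nonpos fun j _ => ?_
    rcases unusedService_cases q a τ i j with h | h
    · rw [h, mul_zero]
    · rw [h.1, mul_one]; exact hd i j h.2.1
  linarith

lemma frob_self_le_of_abs_le {x : Fin n → Fin n → ℝ} {c : ℝ} (hx : ∀ i j, |x i j| ≤ c) :
    frob x x ≤ n ^ 2 * c ^ 2 := by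
  have : ∀ i j, x i j * x i j ≤ c ^ 2 := fun i j => by
    rw [← sq, ← sq_abs]
    exact pow_le_pow_left₀ (abs_nonneg _) (hx i j) 2
  refine (Finset.sum_le_sum fun i _ => Finset.sum_le_sum fun j _ => this i j).trans ?_
  simp only [Finset.sum_const, Finset.card_univ, Fintype.card_fin, nsmul_eq_mul]
  exact le_of_eq (by ring)

end Switch

/-! ### Means and variances of the arrivals. -/

section Arrivals

variable {n : ℕ} {A : PMF (SwitchState n)} {amax : ℕ} {rate : Matrix (Fin n) (Fin n) ℝ}

lemma IsArrivalLaw.finite_support (hA : IsArrivalLaw A amax rate) : A.support.Finite :=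
  (Set.finite_Iic (fun _ _ => amax : SwitchState n)).subset fun a ha i j => hA.bounded a ha i j

lemma IsArrivalLaw.integrable (hA : IsArrivalLaw A amax rate) (f : SwitchState n → ℝ) :
    Integrable f A.toMeasure :=
  PMF.integrable_of_finite_support hA.finite_support f

lemma IsArrivalLaw.integral_frob (hA : IsArrivalLaw A amax rate) (d : Fin n → Fin n → ℝ) :
    ∫ a, frob d (realState a) ∂A.toMeasure = frob d rate := by
  simp only [frob]
  rw [integral_finsetSum _ fun i _ => hA.integrable _]
  refine Finset.sum_congr rfl fun i _ => ?_
  rw [integral_finsetSum _ fun j _ => hA.integrable _]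
  refine Finset.sum_congr rfl fun j _ => ?_
  rw [integral_const_mul]
  exact congrArg _ (hA.mean i j)

lemma IsArrivalLaw.integral_entrySum (hA : IsArrivalLaw A amax rate) :
    ∫ a, entrySum (realState a) ∂A.toMeasure = entrySum rate := by
  have := hA.integral_frob 1
  simpa [frob, entrySum] using this

/-- An integer variable of mean less than one vanishes with positive probability, and independence
multiplies these probabilities. -/
lemma IsArrivalLaw.apply_zero_ne_zero (hA : IsArrivalLaw A amax rate)
    (hrate : ∀ i j, rate i j < 1) : A 0 ≠ 0 := by
  have h1 := hA.indep.measure_inter_preimage_eq_mul Finset.univ (sets := fun _ => {0})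
    (fun _ _ => MeasurableSet.of_discrete)
  have h2 : (⋂ p ∈ (Finset.univ : Finset (Fin n × Fin n)),
      (fun a : SwitchState n => a p.1 p.2) ⁻¹' {0}) = {0} := by
    ext a
    simp only [Finset.mem_univ, Set.iInter_true, Set.mem_iInter, Set.mem_preimage,
      Set.mem_singleton_iff, Prod.forall]
    exact ⟨fun h => funext fun i => funext fun j => h i j, fun h i j => by rw [h]; rfl⟩
  rw [h2, A.toMeasure_apply_singleton _ MeasurableSet.of_discrete] at h1
  rw [h1, Finset.prod_ne_zero_iff]
  rintro ⟨i, j⟩ _ h0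
  rw [A.toMeasure_apply_eq_zero_iff MeasurableSet.of_discrete, Set.disjoint_left] at h0
  have h3 : ∫ _, (1 : ℝ) ∂A.toMeasure ≤ ∫ a, (a i j : ℝ) ∂A.toMeasure := by
    refine PMF.integral_mono_of_support (hA.integrable _) (hA.integrable _) fun a ha => ?_
    have := h0 ha
    have : 1 ≤ a i j := Nat.one_le_iff_ne_zero.2 this
    exact_mod_cast this
  rw [hA.mean i j] at h3
  simp only [integral_const, probReal_univ, smul_eq_mul, mul_one] at h3
  exact absurd (hrate i j) (not_lt.2 h3)

/-- The mean of a shifted square. -/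
lemma integral_const_add_sq {Ω : Type*} [MeasurableSpace Ω] {μ : Measure Ω}
    [IsProbabilityMeasure μ] {Y : Ω → ℝ} (hY : MemLp Y 2 μ) (c : ℝ) :
    ∫ ω, (c + Y ω) ^ 2 ∂μ = Var[Y; μ] + (c + ∫ ω, Y ω ∂μ) ^ 2 := by
  have hY1 : Integrable Y μ := hY.integrable one_le_two
  have hY2 : Integrable (fun ω => Y ω ^ 2) μ := hY.integrable_sq
  rw [variance_eq_sub hY]
  have : ∀ ω, (c + Y ω) ^ 2 = c ^ 2 + 2 * c * Y ω + Y ω ^ 2 := fun ω => by ring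
  simp only [this]
  have h1 : Integrable (fun ω => c ^ 2 + 2 * c * Y ω) μ :=
    (integrable_const _).add (hY1.const_mul _)
  rw [integral_add h1 hY2, integral_add (integrable_const _) (hY1.const_mul _),
    integral_const_mul]
  simp only [integral_const, probReal_univ, smul_eq_mul, one_mul, Pi.pow_apply]
  ring

lemma IsArrivalLaw.memLp (hA : IsArrivalLaw A amax rate) (f : SwitchState n → ℝ) :
    MemLp f 2 A.toMeasure :=
  (memLp_two_iff_integrable_sq .of_discrete).2 (hA.integrable _)

lemma IsArrivalLaw.variance_sum (hA : IsArrivalLaw A amax rate) (s : Finset (Fin n × Fin n)) :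
    Var[fun a : SwitchState n => ∑ p ∈ s, (a p.1 p.2 : ℝ); A.toMeasure] =
      ∑ p ∈ s, Var[fun a : SwitchState n => (a p.1 p.2 : ℝ); A.toMeasure] := by
  have h := IndepFun.variance_sum (μ := A.toMeasure) (s := s)
    (X := fun p (a : SwitchState n) => (a p.1 p.2 : ℝ)) (fun p _ => hA.memLp _)
    (fun p _ p' _ hpp' => by
      exact (hA.indep.indepFun hpp').comp (φ := fun m : ℕ => (m : ℝ))
        (ψ := fun m : ℕ => (m : ℝ)) .of_discrete .of_discrete)
  rw [← h]
  congr 1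
  ext a
  simp

end Arrivals

/-! ### From one-step bounds to stationary inequalities. -/

section Step

variable {n : ℕ} {A : PMF (SwitchState n)} {S : SwitchState n → PMF (Equiv.Perm (Fin n))}

lemma finite_support_switchStep (hA : A.support.Finite) (q : SwitchState n) :
    (switchStep A S q).support.Finite := by
  refine PMF.finite_support_bind (Set.toFinite _) fun τ => ?_
  rw [PMF.support_map]
  exact hA.image _

/-- Averaging over the schedule preserves an upper bound, so drifts may be computed with the
schedule fixed and the tie-breaking rule never enters. -/
lemma integral_switchStep_le (hA : A.support.Finite) {f : SwitchState n → ℝ} {q : SwitchState n}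
    {c : ℝ} (h : ∀ τ ∈ (S q).support, ∫ a, f (nextQueue q a τ) ∂A.toMeasure ≤ c) :
    ∫ q', f q' ∂(switchStep A S q).toMeasure ≤ c := by
  let _ : MeasurableSpace (Equiv.Perm (Fin n)) := ⊤
  have : DiscreteMeasurableSpace (Equiv.Perm (Fin n)) := ⟨fun _ => trivial⟩
  rw [switchStep, PMF.integral_bind
    (PMF.integrable_of_finite_support (finite_support_switchStep hA q) f)]
  have h1 : ∀ τ, ∫ q', f q' ∂(A.map fun a => nextQueue q a τ).toMeasure =
      ∫ a, f (nextQueue q a τ) ∂A.toMeasure := fun τ => by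
    rw [← PMF.toMeasure_map (p := A) (hf := Measurable.of_discrete),
      integral_map Measurable.of_discrete.aemeasurable .of_discrete]
  simp only [h1]
  have hfin := fun g : Equiv.Perm (Fin n) → ℝ =>
    PMF.integrable_of_finite_support (p := S q) (Set.toFinite _) g
  refine (PMF.integral_mono_of_support (hfin _) (hfin fun _ => c) h).trans ?_
  simp

/-- The state after one step has the same law, so the mean of `f` there is its stationary mean.
Integrability of `f` and `g` is what later allows terms common to both sides to cancel. -/
lemma IsStationaryLaw.integral_le {Q : PMF (SwitchState n)} (hQ : IsStationaryLaw A S Q)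
    (hA : A.support.Finite) {f g : SwitchState n → ℝ} (hf : Integrable f Q.toMeasure)
    (hg : Integrable g Q.toMeasure)
    (h : ∀ q, ∀ τ ∈ (S q).support, ∫ a, f (nextQueue q a τ) ∂A.toMeasure ≤ g q) :
    ∫ q, f q ∂Q.toMeasure ≤ ∫ q, g q ∂Q.toMeasure := by
  have hf' : Integrable f (Q.bind (switchStep A S)).toMeasure := by rwa [hQ]
  have h1 := PMF.integral_bind hf'
  rw [hQ] at h1
  rw [h1]
  exact integral_mono (PMF.integrable_integral_bind hf') hg fun q =>
    integral_switchStep_le hA (h q)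

end Step

/-! ### Foster–Lyapunov drift and accessibility of the empty state. -/

section Stability

variable {n : ℕ} {A : PMF (SwitchState n)} {S : SwitchState n → PMF (Equiv.Perm (Fin n))}

lemma queueLaw_eq_chainLaw (q₀ : SwitchState n) (t : ℕ) :
    queueLaw A S q₀ t = chainLaw (switchStep A S) q₀ t := by
  induction t with
  | zero => rfl
  | succ t ih => rw [queueLaw, ih, chainLaw]

/-- Without arrivals, a MaxWeight schedule empties the switch packet by packet. -/
lemma sum_nextQueue_zero_le (hS : IsMaxWeight S) {q : SwitchState n} {τ : Equiv.Perm (Fin n)}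
    (hτ : τ ∈ (S q).support) {N : ℕ} (hq : ∑ i, ∑ j, q i j ≤ N + 1) :
    ∑ i, ∑ j, nextQueue q 0 τ i j ≤ N := by
  have hle : ∀ i j, nextQueue q 0 τ i j ≤ q i j := fun i j => by simp [nextQueue]
  by_cases h0 : ∀ i j, q i j = 0
  · have : ∀ i j, nextQueue q 0 τ i j = 0 := fun i j => by simpa [h0] using hle i j
    simp [this]
  push Not at h0
  obtain ⟨i, j, hij⟩ := h0
  -- The transposition connects `i` to the nonempty queue at `j`, so the maximal weight is positive
  -- and some nonempty queue is served.
  have h1 : 0 < scheduleWeight q (Equiv.swap i j) := by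
    refine Finset.sum_pos' (fun _ _ => Nat.zero_le _) ⟨i, Finset.mem_univ _, ?_⟩
    refine Finset.sum_pos' (fun _ _ => Nat.zero_le _) ⟨j, Finset.mem_univ _, ?_⟩
    simpa [switchService] using Nat.pos_of_ne_zero hij
  have h2 := h1.trans_le (hS q τ hτ _)
  obtain ⟨k, -, hk⟩ := Finset.exists_ne_zero_of_sum_ne_zero h2.ne'
  obtain ⟨l, -, hl⟩ := Finset.exists_ne_zero_of_sum_ne_zero hk
  have h3 : nextQueue q 0 τ k l < q k l := by
    have h4 := Nat.pos_of_ne_zero (left_ne_zero_of_mul hl)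
    have h5 := Nat.pos_of_ne_zero (right_ne_zero_of_mul hl)
    simp only [nextQueue, Pi.zero_apply]
    omega
  have h6 : ∑ i, ∑ j, nextQueue q 0 τ i j < ∑ i, ∑ j, q i j := by
    refine Finset.sum_lt_sum (fun i _ => Finset.sum_le_sum fun j _ => hle i j)
      ⟨k, Finset.mem_univ _, ?_⟩
    exact Finset.sum_lt_sum (fun j _ => hle k j) ⟨l, Finset.mem_univ _, h3⟩
  omega

/-- If no packet arrives during `N` slots, each slot removes at least one packet until none is left.
-/
lemma pow_le_chainLaw_zero (hS : IsMaxWeight S) (N : ℕ) (q : SwitchState n)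
    (hq : ∑ i, ∑ j, q i j ≤ N) : A 0 ^ N ≤ chainLaw (switchStep A S) q N 0 := by
  induction N generalizing q with
  | zero =>
    have : q = 0 := by
      ext i j
      have h1 : q i j ≤ ∑ i, ∑ j, q i j :=
        (Finset.single_le_sum (f := fun j => q i j) (fun _ _ => Nat.zero_le _)
          (Finset.mem_univ j)).trans
        (Finset.single_le_sum (f := fun i => ∑ j, q i j) (fun _ _ => Nat.zero_le _)
          (Finset.mem_univ i))
      exact Nat.le_zero.1 (h1.trans hq)
    simp [chainLaw, this]
  | succ N ih =>
    rw [chainLaw_succ', switchStep, PMF.bind_bind, PMF.bind_apply]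
    have h1 : ∀ τ, S q τ * A 0 ^ (N + 1) ≤ S q τ *
        ((A.map fun a => nextQueue q a τ).bind fun q' => chainLaw (switchStep A S) q' N) 0 := by
      intro τ
      by_cases hτ : S q τ = 0
      · simp [hτ]
      refine mul_le_mul_right ?_ _
      rw [PMF.bind_map, PMF.bind_apply, pow_succ']
      refine le_trans ?_ (ENNReal.le_tsum 0)
      have hτ' := (S q).mem_support_iff τ |>.2 hτ
      exact mul_le_mul_right (ih _ (sum_nextQueue_zero_le hS hτ' hq)) _
    refine le_trans (le_of_eq ?_) (ENNReal.tsum_le_tsum h1)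
    rw [ENNReal.tsum_mul_right, (S q).tsum_coe, one_mul]

lemma abs_frob_le_sq_mul {x y : Fin n → Fin n → ℝ} {c d : ℝ} (hc : 0 ≤ c)
    (hx : ∀ i j, |x i j| ≤ c) (hy : ∀ i j, |y i j| ≤ d) : |frob x y| ≤ n ^ 2 * (c * d) := by
  have h : ∀ i j, |x i j * y i j| ≤ c * d := fun i j => by
    rw [abs_mul]
    exact mul_le_mul (hx i j) (hy i j) (abs_nonneg _) hc
  refine (Finset.abs_sum_le_sum_abs _ _).trans ((Finset.sum_le_sum fun i _ =>
    (Finset.abs_sum_le_sum_abs _ _).trans (Finset.sum_le_sum fun j _ => h i j)).trans ?_)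
  simp only [Finset.sum_const, Finset.card_univ, Fintype.card_fin, nsmul_eq_mul]
  exact le_of_eq (by ring)

/-- A smoothed Euclidean norm of the queue lengths. -/
def queueNorm (q : SwitchState n) : ℝ := √(1 + frob (realState q) (realState q))

lemma queueNorm_sq (q : SwitchState n) :
    queueNorm q ^ 2 = 1 + frob (realState q) (realState q) :=
  Real.sq_sqrt (by have := frob_self_nonneg (realState q); linarith)

lemma queueNorm_sq_sub_queueNorm_sq (q' q : SwitchState n) :
    queueNorm q' ^ 2 - queueNorm q ^ 2 =
      2 * frob (realState q) (realState q' - realState q) +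
        frob (realState q' - realState q) (realState q' - realState q) := by
  rw [queueNorm_sq, queueNorm_sq]
  simp only [frob_sub_left, frob_sub_right, frob_comm (realState q') (realState q)]
  ring

lemma one_le_queueNorm (q : SwitchState n) : 1 ≤ queueNorm q := by
  rw [queueNorm, Real.one_le_sqrt]
  have := frob_self_nonneg (realState q)
  linarith

lemma realState_le_queueNorm (q : SwitchState n) (i j : Fin n) :
    realState q i j ≤ queueNorm q := by
  refine (le_abs_self _).trans ((abs_le_sqrt_frob_self _ i j).trans (Real.sqrt_le_sqrt ?_))
  linarith

lemma queueNorm_le_one_add_entrySum (q : SwitchState n) :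
    queueNorm q ≤ 1 + entrySum (realState q) := by
  have h0 : ∀ i j, 0 ≤ realState q i j := realState_nonneg q
  have hT : 0 ≤ entrySum (realState q) :=
    Finset.sum_nonneg fun i _ => Finset.sum_nonneg fun j _ => h0 i j
  have h1 : ∀ i j, |realState q i j| ≤ entrySum (realState q) := fun i j => by
    rw [abs_of_nonneg (h0 i j)]
    exact (Finset.single_le_sum (f := fun j => realState q i j) (fun j _ => h0 i j)
      (Finset.mem_univ j)).trans (Finset.single_le_sum (f := fun i => ∑ j, realState q i j)
      (fun i _ => Finset.sum_nonneg fun j _ => h0 i j) (Finset.mem_univ i))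
  have h2 := (le_abs_self _).trans (abs_frob_le h1 h0)
  rw [queueNorm, Real.sqrt_le_left (by linarith)]
  nlinarith

variable {amax : ℕ} {ν : Matrix (Fin n) (Fin n) ℝ} {ε : ℝ}

lemma frob_rate (x : Fin n → Fin n → ℝ) : frob x (ν - ε • ν) = (1 - ε) * frob x ν := by
  simp only [frob, Matrix.sub_apply, Matrix.smul_apply, smul_eq_mul, Finset.mul_sum]
  exact Finset.sum_congr rfl fun i _ => Finset.sum_congr rfl fun j _ => by ring

lemma exists_forall_le_of_pos (hν : ∀ i j, 0 < ν i j) : ∃ δ > 0, ∀ i j, δ ≤ ν i j := by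
  rcases isEmpty_or_nonempty (Fin n × Fin n) with h | h
  · exact ⟨1, one_pos, fun i j => (h.false (i, j)).elim⟩
  · obtain ⟨p, hp⟩ := Finite.exists_min fun p : Fin n × Fin n => ν p.1 p.2
    exact ⟨ν p.1 p.2, hν _ _, fun i j => hp (i, j)⟩

/-- Negative drift of the norm of the queue lengths. -/
lemma integral_normDrift_le (hν : ν ∈ doublyStochastic ℝ (Fin n)) {δ : ℝ}
    (hδ : 0 < δ) (hδν : ∀ i j, δ ≤ ν i j) (hε : 0 < ε)
    (hA : IsArrivalLaw A amax (ν - ε • ν)) (hS : IsMaxWeight S) {q : SwitchState n}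
    {τ : Equiv.Perm (Fin n)} (hτ : τ ∈ (S q).support) :
    ∫ a, (queueNorm (nextQueue q a τ) ^ 2 - queueNorm q ^ 2) ∂A.toMeasure ≤
      -(2 * (ε * δ)) * (queueNorm q - 1) + n ^ 2 * ((amax : ℝ) + 1) ^ 2 := by
  set x := realState q with hx
  have hpt : ∀ a ∈ A.support, queueNorm (nextQueue q a τ) ^ 2 - queueNorm q ^ 2 ≤
      2 * frob x (realState a) - 2 * frob x (serviceMatrix τ) +
        n ^ 2 * ((amax : ℝ) + 1) ^ 2 := by
    intro a ha
    set z := realState (nextQueue q a τ) - x with hz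
    have h1 := queueNorm_sq_sub_queueNorm_sq (nextQueue q a τ) q
    rw [← hx, ← hz] at h1
    have h2 : frob x z ≤ frob x (realState a - serviceMatrix τ) :=
      frob_nextQueue_sub_le τ fun i j h => by simp [hx, realState, h]
    have h3 : frob z z ≤ n ^ 2 * ((amax : ℝ) + 1) ^ 2 :=
      frob_self_le_of_abs_le (abs_nextQueue_sub_le (hA.bounded a ha) τ)
    rw [frob_sub_right x (realState a)] at h2
    linarith
  refine (PMF.integral_mono_of_support (hA.integrable _) (hA.integrable _) hpt).trans ?_
  rw [integral_add (hA.integrable _) (hA.integrable _),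
    integral_sub (hA.integrable _) (hA.integrable _), integral_const_mul, hA.integral_frob,
    frob_rate]
  simp only [integral_const, probReal_univ, smul_eq_mul, one_mul]
  have h4 := frob_le_of_isMaxWeight hS hτ hν
  have h5 : δ * entrySum x ≤ frob x ν := by
    have : δ * entrySum x = frob x fun _ _ => δ := by
      simp only [frob, entrySum, Finset.mul_sum, mul_comm]
    rw [this]
    exact frob_mono_right (realState_nonneg q) hδν
  have h6 : queueNorm q - 1 ≤ entrySum x := by
    have := queueNorm_le_one_add_entrySum q
    linarith
  have h7 : ε * (δ * (queueNorm q - 1)) ≤ ε * frob x ν :=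
    mul_le_mul_of_nonneg_left ((mul_le_mul_of_nonneg_left h6 hδ.le).trans h5) hε.le
  linarith

lemma abs_queueNorm_sq_sub_le {q a : SwitchState n} (ha : ∀ i j, a i j ≤ amax)
    (τ : Equiv.Perm (Fin n)) :
    |queueNorm (nextQueue q a τ) ^ 2 - queueNorm q ^ 2| ≤
      3 * n ^ 2 * ((amax : ℝ) + 1) ^ 2 * queueNorm q := by
  set x := realState q with hx
  set z := realState (nextQueue q a τ) - x with hz
  have h1 := queueNorm_sq_sub_queueNorm_sq (nextQueue q a τ) q
  rw [← hx, ← hz] at h1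
  have hN := one_le_queueNorm q
  have hb : ∀ i j, |z i j| ≤ (amax : ℝ) + 1 := abs_nextQueue_sub_le ha τ
  have h2 := abs_frob_le_sq_mul (x := x) (c := queueNorm q) (by linarith)
    (fun i j => by rw [abs_of_nonneg (realState_nonneg q i j)]; exact realState_le_queueNorm q i j)
    hb
  have h3 := abs_frob_le_sq_mul (x := z) (by positivity) hb hb
  have hb1 : (1 : ℝ) ≤ (amax : ℝ) + 1 := by
    have : (0 : ℝ) ≤ amax := Nat.cast_nonneg _
    linarith
  set b : ℝ := (amax : ℝ) + 1
  have h4 : (n : ℝ) ^ 2 * (queueNorm q * b) ≤ n ^ 2 * b ^ 2 * queueNorm q := by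
    have : queueNorm q * b ≤ b ^ 2 * queueNorm q := by
      nlinarith [mul_nonneg (mul_nonneg (by linarith : 0 ≤ queueNorm q) (by linarith : 0 ≤ b))
        (by linarith : 0 ≤ b - 1)]
    nlinarith [sq_nonneg (n : ℝ)]
  have h5 : (n : ℝ) ^ 2 * (b * b) ≤ n ^ 2 * b ^ 2 * queueNorm q := by
    have : (0 : ℝ) ≤ n ^ 2 * b ^ 2 := by positivity
    nlinarith
  rw [h1]
  calc |2 * frob x z + frob z z| ≤ |2 * frob x z| + |frob z z| := abs_add_le _ _
    _ = 2 * |frob x z| + |frob z z| := by rw [abs_mul, abs_two]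
    _ ≤ _ := by linarith

/-- Far from the origin the norm has bounded increments of negative mean, and for small `θ` the
exponential turns this additive drift into a multiplicative one. This is the geometric drift that
Harris' theorem needs, and it also yields all moments. -/
lemma exists_exp_drift (hn : 0 < n) (hν : ν ∈ doublyStochastic ℝ (Fin n))
    (hν_pos : ∀ i j, 0 < ν i j) (hε : 0 < ε)
    (hA : IsArrivalLaw A amax (ν - ε • ν)) (hS : IsMaxWeight S) :
    ∃ θ γ K : ℝ, 0 < θ ∧ 0 ≤ γ ∧ γ < 1 ∧ 0 ≤ K ∧ ∀ q,
      ∫ q', Real.exp (θ * queueNorm q') ∂(switchStep A S q).toMeasure ≤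
        γ * Real.exp (θ * queueNorm q) + K := by
  obtain ⟨δ, hδ, hδν⟩ := exists_forall_le_of_pos hν_pos
  set B : ℝ := n ^ 2 * ((amax : ℝ) + 1) ^ 2 with hB
  have hB0 : 0 < B := by
    have : (0 : ℝ) < n := by exact_mod_cast hn
    positivity
  obtain ⟨c, hc⟩ : ∃ c, c = ε * δ := ⟨_, rfl⟩
  have hc0 : 0 < c := hc ▸ mul_pos hε hδ
  obtain ⟨β, hβ⟩ : ∃ β, β = 2 * B := ⟨_, rfl⟩
  have hβ0 : 0 < β := by rw [hβ]; positivity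
  -- The first bound allows a second-order estimate of the exponential; the second keeps the
  -- quadratic term below half of the linear drift `θ * c / 2`.
  obtain ⟨θ, hθ0, hθ1, hθ2⟩ : ∃ θ : ℝ, 0 < θ ∧ θ * β ≤ 1 ∧ θ * β ^ 2 ≤ c / 4 := by
    refine ⟨min (1 / β) (c / 4 / β ^ 2), by positivity, ?_, ?_⟩
    · exact (mul_le_mul_of_nonneg_right (min_le_left _ _) hβ0.le).trans (by field_simp; rfl)
    · refine (mul_le_mul_of_nonneg_right (min_le_right _ _) (by positivity)).trans ?_
      rw [div_mul_cancel₀ _ (by positivity)]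
  -- The level beyond which `-2c(N - 1) + B ≤ -cN`.
  obtain ⟨R, hR⟩ : ∃ R, R = (2 * c + B) / c := ⟨_, rfl⟩
  refine ⟨θ, max (1 - θ * c / 4) 0, Real.exp (θ * (R + β)), hθ0, le_max_right _ _,
    max_lt (by have := mul_pos hθ0 hc0; linarith) one_pos, (Real.exp_pos _).le, fun q => ?_⟩
  refine integral_switchStep_le hA.finite_support fun τ hτ => ?_
  set N := queueNorm q with hN
  have hN1 : 1 ≤ N := one_le_queueNorm q
  have hN0 : 0 < N := by linarith
  set Y : SwitchState n → ℝ := fun a => (queueNorm (nextQueue q a τ) ^ 2 - N ^ 2) / (2 * N) with hY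
  -- Concavity of the square root reduces the increment of the norm to that of its square, whose
  -- drift is explicit.
  have hYN : ∀ a, queueNorm (nextQueue q a τ) ≤ N + Y a := by
    intro a
    have h : (queueNorm (nextQueue q a τ) - N) ^ 2 ≥ 0 := sq_nonneg _
    have h2 : N + Y a - queueNorm (nextQueue q a τ) =
        (queueNorm (nextQueue q a τ) - N) ^ 2 / (2 * N) := by
      rw [hY]; field_simp; ring
    have h3 : 0 ≤ (queueNorm (nextQueue q a τ) - N) ^ 2 / (2 * N) := by positivity
    linarith
  have hYβ : ∀ a ∈ A.support, |Y a| ≤ β := by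
    intro a ha
    rw [hY]
    dsimp only
    rw [abs_div, abs_of_pos (by positivity : 0 < 2 * N), div_le_iff₀ (by positivity), hβ]
    refine (abs_queueNorm_sq_sub_le (hA.bounded a ha) τ).trans ?_
    have : 3 * (n : ℝ) ^ 2 * ((amax : ℝ) + 1) ^ 2 = 3 * B := by rw [hB]; ring
    rw [this, ← hN]
    nlinarith [mul_pos hB0 hN0]
  have hV0 := Real.exp_pos (θ * N)
  by_cases hNR : R ≤ N
  · have hEY : ∫ a, Y a ∂A.toMeasure ≤ -c / 2 := by
      rw [hY, integral_div, div_le_iff₀ (by positivity)]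
      refine (integral_normDrift_le hν hδ hδν hε hA hS hτ).trans ?_
      rw [← hc, ← hB, ← hN]
      rw [hR, div_le_iff₀ hc0] at hNR
      nlinarith
    have hpt : ∀ a ∈ A.support, Real.exp (θ * queueNorm (nextQueue q a τ)) ≤
        Real.exp (θ * N) * (1 + θ * Y a + θ ^ 2 * β ^ 2) := by
      intro a ha
      have h1 : θ * queueNorm (nextQueue q a τ) ≤ θ * N + θ * Y a := by
        rw [← mul_add]
        exact mul_le_mul_of_nonneg_left (hYN a) hθ0.le
      refine (Real.exp_le_exp.2 h1).trans ?_
      rw [Real.exp_add]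
      refine mul_le_mul_of_nonneg_left ?_ hV0.le
      have h2 : |θ * Y a| ≤ θ * β := by
        rw [abs_mul, abs_of_pos hθ0]
        exact mul_le_mul_of_nonneg_left (hYβ a ha) hθ0.le
      have h3 := (abs_le.1 (Real.abs_exp_sub_one_sub_id_le (h2.trans hθ1))).2
      have h4 : (θ * Y a) ^ 2 ≤ (θ * β) ^ 2 := sq_le_sq' (by linarith [(abs_le.1 h2).1])
        (abs_le.1 h2).2
      rw [mul_pow θ β] at h4
      linarith
    refine (PMF.integral_mono_of_support (hA.integrable _) (hA.integrable _) hpt).trans ?_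
    rw [integral_const_mul, integral_add (hA.integrable _) (hA.integrable _),
      integral_add (hA.integrable _) (hA.integrable _), integral_const_mul]
    simp only [integral_const, probReal_univ, smul_eq_mul, one_mul]
    have h5 : 1 + θ * ∫ a, Y a ∂A.toMeasure + θ ^ 2 * β ^ 2 ≤ 1 - θ * c / 4 := by
      have h6 := mul_le_mul_of_nonneg_left hEY hθ0.le
      have h7 := mul_le_mul_of_nonneg_left hθ2 hθ0.le
      nlinarith
    have h8 := mul_le_mul_of_nonneg_left (h5.trans (le_max_left _ 0)) hV0.le
    have := (Real.exp_pos (θ * (R + β))).le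
    linarith
  · have hpt : ∀ a ∈ A.support, Real.exp (θ * queueNorm (nextQueue q a τ)) ≤
        Real.exp (θ * (R + β)) := by
      intro a ha
      refine Real.exp_le_exp.2 (mul_le_mul_of_nonneg_left ?_ hθ0.le)
      have := hYN a
      have := (abs_le.1 (hYβ a ha)).2
      linarith
    refine (PMF.integral_mono_of_support (hA.integrable _) (hA.integrable _) hpt).trans ?_
    simp only [integral_const, probReal_univ, smul_eq_mul, one_mul]
    have : 0 ≤ max (1 - θ * c / 4) 0 * Real.exp (θ * N) :=
      mul_nonneg (le_max_right _ _) hV0.le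
    linarith

/-- The queue length process is ergodic, and its stationary law has all moments. -/
theorem exists_stationaryLaw (hn : 0 < n) (hν : ν ∈ doublyStochastic ℝ (Fin n))
    (hν_pos : ∀ i j, 0 < ν i j) (hε : 0 < ε)
    (hA : IsArrivalLaw A amax (ν - ε • ν)) (hS : IsMaxWeight S) :
    ∃ Q : PMF (SwitchState n), IsStationaryLaw A S Q ∧
      (∀ m : ℕ, Integrable (fun q => queueNorm q ^ m) Q.toMeasure) ∧
      (∀ q₀ q, Tendsto (fun t => queueLaw A S q₀ t q) atTop (𝓝 (Q q))) ∧
      ∀ Q', IsStationaryLaw A S Q' → Q' = Q := by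
  obtain ⟨θ, γ, K, hθ, hγ0, hγ1, hK, hdrift⟩ := exists_exp_drift hn hν hν_pos hε hA hS
  have hrate : ∀ i j, (ν - ε • ν) i j < 1 := fun i j => by
    have h1 := le_one_of_mem_doublyStochastic hν (i := i) (j := j)
    have h2 := mul_pos hε (hν_pos i j)
    simp only [Matrix.sub_apply, Matrix.smul_apply, smul_eq_mul]
    linarith
  have hA0 : 0 < (A 0).toReal :=
    ENNReal.toReal_pos (hA.apply_zero_ne_zero hrate) (A.apply_ne_top 0)
  have hsub : ∀ (L : ℝ) (q : SwitchState n), Real.exp (θ * queueNorm q) ≤ L →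
      ∀ i j, q i j ≤ ⌈L / θ⌉₊ := by
    intro L q hq i j
    have h1 := Real.add_one_le_exp (θ * queueNorm q)
    have h2 : queueNorm q ≤ L / θ := by rw [le_div_iff₀ hθ]; linarith
    have h3 : (q i j : ℝ) ≤ ⌈L / θ⌉₊ :=
      (realState_le_queueNorm q i j).trans (h2.trans (Nat.le_ceil _))
    exact_mod_cast h3
  obtain ⟨Q, hQ, hint, hlim, huniq⟩ := exists_stationary_of_drift (P := switchStep A S)
    (V := fun q => Real.exp (θ * queueNorm q))
    (fun q => finite_support_switchStep hA.finite_support q) (fun q => (Real.exp_pos _).le)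
    (fun L => (Set.finite_Iic (fun _ _ => ⌈L / θ⌉₊ : SwitchState n)).subset
      fun q hq i j => hsub L q hq i j) hγ0 hγ1 hK hdrift (o := 0) (by
      intro L
      refine ⟨n * (n * ⌈L / θ⌉₊), fun N hN => ⟨(A 0).toReal ^ N, pow_pos hA0 N, fun q hq => ?_⟩⟩
      rw [← ENNReal.toReal_pow]
      refine ENNReal.toReal_mono (PMF.apply_ne_top _ _) (pow_le_chainLaw_zero hS N q ?_)
      refine le_trans ?_ hN
      refine (Finset.sum_le_sum fun i _ => Finset.sum_le_sum fun j _ => hsub L q hq i j).trans ?_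
      simp)
  refine ⟨Q, hQ, fun m => ?_, fun q₀ q => ?_, huniq⟩
  · have h1 : ∀ q : SwitchState n, queueNorm q ^ m ≤
        (m.factorial / θ ^ m) * Real.exp (θ * queueNorm q) := by
      intro q
      have h0 : 0 ≤ θ * queueNorm q := mul_nonneg hθ.le (by linarith [one_le_queueNorm q])
      have h2 := Real.pow_div_factorial_le_exp _ h0 m
      have h3 : (0 : ℝ) < m.factorial := by exact_mod_cast m.factorial_pos
      rw [div_le_iff₀ h3, mul_pow] at h2
      rw [div_mul_eq_mul_div, le_div_iff₀ (by positivity)]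
      linarith
    refine (hint.const_mul (m.factorial / θ ^ m)).mono' .of_discrete (ae_of_all _ fun q => ?_)
    rw [Real.norm_of_nonneg (pow_nonneg (by linarith [one_le_queueNorm q]) m)]
    exact h1 q
  · simp only [queueLaw_eq_chainLaw]
    exact hlim q₀ q

end Stability

/-! ### State space collapse and the stationary balance of the quadratic form. -/

section HeavyTraffic

variable {n : ℕ} {A : PMF (SwitchState n)} {S : SwitchState n → PMF (Equiv.Perm (Fin n))}
  {amax : ℕ} {ν : Matrix (Fin n) (Fin n) ℝ} {ε : ℝ} {Q : PMF (SwitchState n)}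

lemma entrySum_of_mem_doublyStochastic {M : Matrix (Fin n) (Fin n) ℝ}
    (hM : M ∈ doublyStochastic ℝ (Fin n)) : entrySum M = n := by
  simp [entrySum, sum_row_of_mem_doublyStochastic hM]

/-- Drift of the fourth power of the distance from the cone. -/
lemma integral_coneDist_pow_four_le (hν : ν ∈ doublyStochastic ℝ (Fin n)) {δ : ℝ}
    (hδ : 0 < δ) (hδν : ∀ i j, δ ≤ ν i j) (hε : 0 < ε) (hεδ : ε * (2 * n) ≤ δ)
    (hA : IsArrivalLaw A amax (ν - ε • ν)) (hS : IsMaxWeight S) {C : ℝ}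
    (hC : C = n ^ 2 * ((amax : ℝ) + 1) ^ 2) {q : SwitchState n} {τ : Equiv.Perm (Fin n)}
    (hτ : τ ∈ (S q).support) :
    ∫ a, coneDist (realState (nextQueue q a τ)) ^ 4 ∂A.toMeasure ≤
      coneDist (realState q) ^ 4 - δ * coneDist (realState q) ^ 2 +
        (δ + (2 * C + 8 * C ^ 2) ^ 3 / δ ^ 2 + 2 * C ^ 2) := by
  set x := realState q with hx
  set d := conePerp x with hd
  set D := coneDist x with hD
  have hD0 : 0 ≤ D := coneDist_nonneg x
  have hC0 : 0 ≤ C := by rw [hC]; positivity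
  have hpt : ∀ a ∈ A.support, coneDist (realState (nextQueue q a τ)) ^ 4 ≤
      D ^ 4 + 2 * D ^ 2 * (2 * frob d (realState a) - 2 * frob d (serviceMatrix τ) + C) +
        C ^ 2 * (8 * D ^ 2 + 2) := by
    intro a ha
    set z := realState (nextQueue q a τ) - x with hz
    have hb : ∀ i j, |z i j| ≤ (amax : ℝ) + 1 := abs_nextQueue_sub_le (hA.bounded a ha) τ
    -- The projection of the old state serves as a competitor for the distance of the new one.
    have h1 : coneDist (realState (nextQueue q a τ)) ^ 2 ≤
        D ^ 2 + (2 * frob d z + frob z z) := by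
      refine (coneDist_sq_le _ (coneProj_mem x)).trans (le_of_eq ?_)
      have h : realState (nextQueue q a τ) - coneProj x = d + z := by
        rw [hz, hd, conePerp]; abel
      rw [h, frob_add_left, frob_add_right, frob_add_right, frob_comm z d, hD, coneDist_sq, ← hd]
      ring
    -- At an empty queue the remainder is minus an entry of the projection, hence nonpositive, so
    -- unused service does no harm.
    have h2 : frob d z ≤ frob d (realState a - serviceMatrix τ) := by
      refine frob_nextQueue_sub_le τ fun i j h => ?_
      have h3 : x i j = 0 := by simp [hx, realState, h]
      have h4 := (coneProj_mem x).2 i j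
      rw [hd, conePerp, Pi.sub_apply, Pi.sub_apply, h3]
      linarith
    rw [frob_sub_right d (realState a)] at h2
    have h3 : frob z z ≤ C := hC ▸ frob_self_le_of_abs_le hb
    have h4 := abs_frob_le_sq_mul hD0 (abs_conePerp_le x) hb
    have h5 : |2 * frob d z + frob z z| ≤ C * (2 * D + 1) := by
      have h6 : |frob d z| ≤ C * D := by
        refine h4.trans ?_
        rw [hC]
        have h7 : (1 : ℝ) ≤ (amax : ℝ) + 1 := by
          have : (0 : ℝ) ≤ amax := Nat.cast_nonneg _
          linarith
        have h8 : D * ((amax : ℝ) + 1) ≤ ((amax : ℝ) + 1) ^ 2 * D := by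
          nlinarith [mul_nonneg (mul_nonneg hD0 (by linarith : (0 : ℝ) ≤ (amax : ℝ) + 1))
            (by linarith : (0 : ℝ) ≤ (amax : ℝ) + 1 - 1)]
        rw [mul_assoc]
        exact mul_le_mul_of_nonneg_left h8 (by positivity)
      have h9 := frob_self_nonneg z
      rw [abs_le] at h6 ⊢
      constructor <;> linarith [h6.1, h6.2]
    set Z := 2 * frob d z + frob z z with hZ
    have h10 : Z ^ 2 ≤ C ^ 2 * (8 * D ^ 2 + 2) := by
      have h11 := pow_le_pow_left₀ (abs_nonneg _) h5 2
      rw [sq_abs] at h11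
      nlinarith [mul_nonneg (sq_nonneg C) (sq_nonneg (2 * D - 1))]
    have h12 : coneDist (realState (nextQueue q a τ)) ^ 4 ≤ (D ^ 2 + Z) ^ 2 := by
      have := pow_le_pow_left₀ (sq_nonneg _) h1 2
      rwa [← pow_mul] at this
    have h13 : Z ≤ 2 * frob d (realState a) - 2 * frob d (serviceMatrix τ) + C := by linarith
    have h14 := mul_le_mul_of_nonneg_left h13 (by positivity : 0 ≤ 2 * D ^ 2)
    nlinarith
  refine (PMF.integral_mono_of_support (hA.integrable _) (hA.integrable _) hpt).trans ?_
  rw [integral_add (hA.integrable _) (hA.integrable _),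
    integral_add (hA.integrable _) (hA.integrable _), integral_const_mul,
    integral_add (hA.integrable _) (hA.integrable _),
    integral_sub (hA.integrable _) (hA.integrable _), integral_const_mul, hA.integral_frob,
    frob_rate]
  simp only [integral_const, probReal_univ, smul_eq_mul, one_mul]
  have h1 := frob_add_coneDist_le_of_isMaxWeight hS hτ hν hδ.le hδν
  -- All doubly stochastic matrices have the same weight on the cone, so the gain `δ * D` of
  -- MaxWeight over `ν` is a gain on the remainder alone.
  have h2 : frob (coneProj x) (serviceMatrix τ) = frob (coneProj x) ν := by
    refine frob_eq_of_mem_collapseCone (coneProj_mem x) (fun i => ?_) fun j => ?_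
    · rw [rowSum_serviceMatrix, sum_row_of_mem_doublyStochastic hν]
    · rw [colSum_serviceMatrix, sum_col_of_mem_doublyStochastic hν]
  have h3 : frob d ν + δ * D ≤ frob d (serviceMatrix τ) := by
    have e1 : frob d ν = frob x ν - frob (coneProj x) ν := frob_sub_left _ _ _
    have e2 : frob d (serviceMatrix τ) = frob x (serviceMatrix τ) -
        frob (coneProj x) (serviceMatrix τ) := frob_sub_left _ _ _
    linarith
  have h4 := (abs_le.1 (abs_frob_le (abs_conePerp_le x)
    (fun i j => hδ.le.trans (hδν i j)))).1
  rw [entrySum_of_mem_doublyStochastic hν] at h4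
  -- The load deficit contributes at most `2 * ε * n * D`, which is half of the gain `2 * δ * D` by
  -- the bound on `ε`.
  have h5 : 2 * ((1 - ε) * frob d ν) - 2 * frob d (serviceMatrix τ) + C ≤ -(δ * D) + C := by
    have h6 := mul_le_mul_of_nonneg_left h4 hε.le
    have h7 := mul_le_mul_of_nonneg_right hεδ hD0
    linarith
  have h8 := mul_le_mul_of_nonneg_left h5 (by positivity : 0 ≤ 2 * D ^ 2)
  -- The drift is now at most `-2δD³ + αD² + 2C²`. One `δD³` absorbs `αD²` up to `α³/δ²`, according
  -- to whether `α ≤ δD`; the other dominates `δ(D² - 1)`. The fourth power is used because the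
  -- square would control only the first moment of `D`.
  obtain ⟨α, hα⟩ : ∃ α, α = 2 * C + 8 * C ^ 2 := ⟨_, rfl⟩
  have hα0 : 0 ≤ α := by rw [hα]; positivity
  have h9 : α * D ^ 2 ≤ δ * D ^ 3 + α ^ 3 / δ ^ 2 := by
    by_cases h : α ≤ δ * D
    · have h10 := mul_le_mul_of_nonneg_right h (sq_nonneg D)
      have h11 : 0 ≤ α ^ 3 / δ ^ 2 := by positivity
      nlinarith
    · have h10 : D ≤ α / δ := by rw [le_div_iff₀ hδ]; linarith
      have h11 := mul_le_mul_of_nonneg_left (pow_le_pow_left₀ hD0 h10 2) hα0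
      have h12 : α * (α / δ) ^ 2 = α ^ 3 / δ ^ 2 := by rw [div_pow]; ring
      have h13 : 0 ≤ δ * D ^ 3 := by positivity
      linarith
  have h14 : D ^ 2 ≤ 1 + D ^ 3 := by
    by_cases h : D ≤ 1
    · have : D ^ 2 ≤ 1 := pow_le_one₀ hD0 h
      have : 0 ≤ D ^ 3 := by positivity
      linarith
    · nlinarith [mul_nonneg (sq_nonneg D) (by linarith : 0 ≤ D - 1)]
  have h15 := mul_le_mul_of_nonneg_left h14 hδ.le
  rw [← hα]
  have h16 : 2 * D ^ 2 * C + C ^ 2 * (8 * D ^ 2 + 2) = α * D ^ 2 + 2 * C ^ 2 := by rw [hα]; ring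
  nlinarith

lemma integrable_of_abs_le_queueNorm_pow
    (hmom : ∀ m : ℕ, Integrable (fun q => queueNorm q ^ m) Q.toMeasure)
    {f : SwitchState n → ℝ} (c : ℝ) (m : ℕ) (hf : ∀ q, |f q| ≤ c * queueNorm q ^ m) :
    Integrable f Q.toMeasure :=
  ((hmom m).const_mul c).mono' .of_discrete (ae_of_all _ hf)

lemma coneDist_le_queueNorm (q : SwitchState n) : coneDist (realState q) ≤ queueNorm q := by
  rw [← Real.sqrt_sq (coneDist_nonneg _), queueNorm]
  exact Real.sqrt_le_sqrt ((coneDist_sq_le_frob_self _).trans (by linarith))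

lemma integrable_coneDist_pow
    (hmom : ∀ m : ℕ, Integrable (fun q => queueNorm q ^ m) Q.toMeasure) (m : ℕ) :
    Integrable (fun q => coneDist (realState q) ^ m) Q.toMeasure :=
  integrable_of_abs_le_queueNorm_pow hmom 1 m fun q => by
    rw [abs_of_nonneg (pow_nonneg (coneDist_nonneg _) m), one_mul]
    exact pow_le_pow_left₀ (coneDist_nonneg _) (coneDist_le_queueNorm q) m

lemma integrable_realState
    (hmom : ∀ m : ℕ, Integrable (fun q => queueNorm q ^ m) Q.toMeasure) (i j : Fin n) :
    Integrable (fun q => realState q i j) Q.toMeasure :=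
  integrable_of_abs_le_queueNorm_pow hmom 1 1 fun q => by
    rw [abs_of_nonneg (realState_nonneg q i j), one_mul, pow_one]
    exact realState_le_queueNorm q i j

lemma integrable_frob_realState
    (hmom : ∀ m : ℕ, Integrable (fun q => queueNorm q ^ m) Q.toMeasure)
    (y : Fin n → Fin n → ℝ) : Integrable (fun q => frob y (realState q)) Q.toMeasure :=
  integrable_finsetSum _ fun i _ => integrable_finsetSum _ fun j _ =>
    (integrable_realState hmom i j).const_mul _

lemma integrable_entrySum_realState
    (hmom : ∀ m : ℕ, Integrable (fun q => queueNorm q ^ m) Q.toMeasure) :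
    Integrable (fun q => entrySum (realState q)) Q.toMeasure :=
  integrable_finsetSum _ fun i _ => integrable_finsetSum _ fun j _ => integrable_realState hmom i j

lemma integrable_marginForm_realState (hn : 0 < n)
    (hmom : ∀ m : ℕ, Integrable (fun q => queueNorm q ^ m) Q.toMeasure) :
    Integrable (fun q => marginForm (realState q) (realState q)) Q.toMeasure := by
  refine integrable_of_abs_le_queueNorm_pow hmom (3 * n ^ 2) 2 fun q => ?_
  have h0 : ∀ i j, |realState q i j| ≤ queueNorm q := fun i j => by
    rw [abs_of_nonneg (realState_nonneg q i j)]
    exact realState_le_queueNorm q i j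
  refine (abs_marginForm_le hn h0 (realState_nonneg q)).trans ?_
  have h1 : entrySum (realState q) ≤ n ^ 2 * queueNorm q := by
    refine (Finset.sum_le_sum fun i _ => Finset.sum_le_sum fun j _ =>
      realState_le_queueNorm q i j).trans (le_of_eq ?_)
    simp only [Finset.sum_const, Finset.card_univ, Fintype.card_fin, nsmul_eq_mul]
    ring
  have h2 := one_le_queueNorm q
  have := mul_le_mul_of_nonneg_left h1 (by linarith : 0 ≤ 3 * queueNorm q)
  linarith

/-- State space collapse: the distance from the cone has a second moment that is bounded
uniformly in the traffic intensity. -/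
lemma integral_coneDist_sq_le (hν : ν ∈ doublyStochastic ℝ (Fin n)) {δ : ℝ}
    (hδ : 0 < δ) (hδν : ∀ i j, δ ≤ ν i j) (hε : 0 < ε) (hεδ : ε * (2 * n) ≤ δ)
    (hA : IsArrivalLaw A amax (ν - ε • ν)) (hS : IsMaxWeight S) (hQ : IsStationaryLaw A S Q)
    (hmom : ∀ m : ℕ, Integrable (fun q => queueNorm q ^ m) Q.toMeasure) {C : ℝ}
    (hC : C = n ^ 2 * ((amax : ℝ) + 1) ^ 2) :
    ∫ q, coneDist (realState q) ^ 2 ∂Q.toMeasure ≤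
      (δ + (2 * C + 8 * C ^ 2) ^ 3 / δ ^ 2 + 2 * C ^ 2) / δ := by
  have h4 := integrable_coneDist_pow hmom 4
  have h2 := integrable_coneDist_pow hmom 2
  have h := hQ.integral_le hA.finite_support h4
    ((h4.sub (h2.const_mul δ)).add (integrable_const _)) fun q τ hτ =>
      integral_coneDist_pow_four_le hν hδ hδν hε hεδ hA hS hC hτ
  have e : ∫ q, (coneDist (realState q) ^ 4 - δ * coneDist (realState q) ^ 2 +
      (δ + (2 * C + 8 * C ^ 2) ^ 3 / δ ^ 2 + 2 * C ^ 2)) ∂Q.toMeasure =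
      ∫ q, (coneDist (realState q) ^ 4 - δ * coneDist (realState q) ^ 2) ∂Q.toMeasure +
        ∫ _, (δ + (2 * C + 8 * C ^ 2) ^ 3 / δ ^ 2 + 2 * C ^ 2) ∂Q.toMeasure :=
    integral_add (h4.sub (h2.const_mul δ)) (integrable_const _)
  rw [integral_sub h4 (h2.const_mul δ), integral_const_mul] at e
  replace h := h.trans (le_of_eq e)
  simp only [integral_const, probReal_univ, smul_eq_mul, one_mul] at h
  rw [le_div_iff₀ hδ]
  linarith

/-- Each row, column and total sum is a constant plus independent arrivals, so its mean square is
variance plus squared mean. Schedules shift these sums by fixed amounts, whence the result is free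
of `τ`. The variances enter with weight `1/n + 1/n - 1/n²`, the diagonal entry of the projection. -/
lemma integral_marginForm_arrivals (hn : 0 < n) (hν : ν ∈ doublyStochastic ℝ (Fin n))
    (hA : IsArrivalLaw A amax (ν - ε • ν)) (x : Fin n → Fin n → ℝ) (τ : Equiv.Perm (Fin n)) :
    ∫ a, marginForm (x + (realState a - serviceMatrix τ)) (x + (realState a - serviceMatrix τ))
      ∂A.toMeasure = marginForm x x - 2 * ε / n * entrySum x +
        (2 * n - 1) / n ^ 2 *
          (∑ i, ∑ j, Var[fun a : SwitchState n => (a i j : ℝ); A.toMeasure]) + ε ^ 2 := by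
  have hn' : (n : ℝ) ≠ 0 := by positivity
  set v : Fin n → Fin n → ℝ := fun i j => Var[fun a : SwitchState n => (a i j : ℝ); A.toMeasure]
    with hv
  have hrow : ∀ i, ∫ a, (∑ j, (x + (realState a - serviceMatrix τ)) i j) *
      (∑ j, (x + (realState a - serviceMatrix τ)) i j) ∂A.toMeasure =
        ∑ j, v i j + (∑ j, x i j - ε) ^ 2 := by
    intro i
    have h1 : ∀ a : SwitchState n, (∑ j, (x + (realState a - serviceMatrix τ)) i j) *
        (∑ j, (x + (realState a - serviceMatrix τ)) i j) =
          ((∑ j, x i j - 1) + ∑ p ∈ {i} ×ˢ Finset.univ, (a p.1 p.2 : ℝ)) ^ 2 := fun a => by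
      simp only [Pi.add_apply, Pi.sub_apply, Finset.sum_add_distrib, Finset.sum_sub_distrib,
        rowSum_serviceMatrix, Finset.sum_product, Finset.sum_singleton, realState]
      ring
    simp only [h1]
    rw [integral_const_add_sq (hA.memLp _), hA.variance_sum,
      integral_finsetSum _ fun p _ => hA.integrable _]
    simp only [hA.mean, Finset.sum_product, Finset.sum_singleton, Matrix.sub_apply,
      Matrix.smul_apply, smul_eq_mul, Finset.sum_sub_distrib, ← Finset.mul_sum,
      sum_row_of_mem_doublyStochastic hν, hv]
    ring
  have hcol : ∀ j, ∫ a, (∑ i, (x + (realState a - serviceMatrix τ)) i j) *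
      (∑ i, (x + (realState a - serviceMatrix τ)) i j) ∂A.toMeasure =
        ∑ i, v i j + (∑ i, x i j - ε) ^ 2 := by
    intro j
    have h1 : ∀ a : SwitchState n, (∑ i, (x + (realState a - serviceMatrix τ)) i j) *
        (∑ i, (x + (realState a - serviceMatrix τ)) i j) =
          ((∑ i, x i j - 1) + ∑ p ∈ Finset.univ ×ˢ {j}, (a p.1 p.2 : ℝ)) ^ 2 := fun a => by
      simp only [Pi.add_apply, Pi.sub_apply, Finset.sum_add_distrib, Finset.sum_sub_distrib,
        colSum_serviceMatrix, Finset.sum_product, Finset.sum_singleton, realState]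
      ring
    simp only [h1]
    rw [integral_const_add_sq (hA.memLp _), hA.variance_sum,
      integral_finsetSum _ fun p _ => hA.integrable _]
    simp only [hA.mean, Finset.sum_product, Finset.sum_singleton, Matrix.sub_apply,
      Matrix.smul_apply, smul_eq_mul, Finset.sum_sub_distrib, ← Finset.mul_sum,
      sum_col_of_mem_doublyStochastic hν, hv]
    ring
  have htot : ∫ a, entrySum (x + (realState a - serviceMatrix τ)) *
      entrySum (x + (realState a - serviceMatrix τ)) ∂A.toMeasure =
        ∑ i, ∑ j, v i j + (entrySum x - n * ε) ^ 2 := by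
    have h1 : ∀ a : SwitchState n, entrySum (x + (realState a - serviceMatrix τ)) *
        entrySum (x + (realState a - serviceMatrix τ)) =
          ((entrySum x - n) + ∑ p ∈ Finset.univ ×ˢ Finset.univ, (a p.1 p.2 : ℝ)) ^ 2 :=
      fun a => by
        rw [entrySum_add, entrySum_sub, entrySum_serviceMatrix, Finset.sum_product]
        simp only [entrySum, realState]
        ring
    simp only [h1]
    rw [integral_const_add_sq (hA.memLp _), hA.variance_sum,
      integral_finsetSum _ fun p _ => hA.integrable _]
    simp only [hA.mean, Finset.sum_product, Matrix.sub_apply,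
      Matrix.smul_apply, smul_eq_mul, Finset.sum_sub_distrib, ← Finset.mul_sum,
      sum_row_of_mem_doublyStochastic hν, Finset.sum_const, Finset.card_univ, Fintype.card_fin,
      nsmul_eq_mul, hv]
    ring
  simp only [marginForm]
  rw [integral_sub (hA.integrable _) (hA.integrable _),
    integral_add (hA.integrable _) (hA.integrable _), integral_div, integral_div, integral_div,
    integral_finsetSum _ fun i _ => hA.integrable _,
    integral_finsetSum _ fun i _ => hA.integrable _, htot]
  simp only [hrow, hcol]
  have hc : ∑ j, ∑ i, v i j = ∑ i, ∑ j, v i j := Finset.sum_comm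
  have hcx : ∑ j, ∑ i, x i j = entrySum x := Finset.sum_comm
  have hrx : ∑ i, ∑ j, x i j = entrySum x := rfl
  simp only [sub_sq, Finset.sum_add_distrib, Finset.sum_sub_distrib, hc, Finset.sum_const,
    Finset.card_univ, Fintype.card_fin, nsmul_eq_mul, ← Finset.sum_mul, ← Finset.mul_sum,
    hcx, hrx, ← sq]
  field_simp
  ring

/-- Pathwise comparison of the quadratic form before and after the truncation at zero. -/
lemma abs_marginForm_nextQueue_sub_le (hn : 0 < n) {κ : ℝ} (hκ : 0 < κ) (q a : SwitchState n)
    (τ : Equiv.Perm (Fin n)) :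
    |marginForm (realState (nextQueue q a τ)) (realState (nextQueue q a τ)) -
      marginForm (realState q + (realState a - serviceMatrix τ))
        (realState q + (realState a - serviceMatrix τ))| ≤
      4 * κ * coneDist (realState (nextQueue q a τ)) ^ 2 +
        (4 * n / κ + 3) * (entrySum (realState (nextQueue q a τ)) -
      entrySum (realState q) - entrySum (realState a) + n) := by
  have h := abs_marginForm_sub_le hn (unusedService_nonneg q a τ) (unusedService_le_one q a τ)
    (nextQueue_mul_unusedService q a τ)
  have h1 : realState (nextQueue q a τ) - unusedService q a τ =
      realState q + (realState a - serviceMatrix τ) := by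
    rw [realState_nextQueue, add_sub_cancel_right]
  rw [h1] at h
  rw [← entrySum_unusedService q a τ]
  refine h.trans ?_
  set D := coneDist (realState (nextQueue q a τ))
  set U := entrySum (unusedService q a τ)
  have hU0 : 0 ≤ U := entrySum_unusedService_nonneg q a τ
  have hUn : U ≤ n := entrySum_unusedService_le q a τ
  -- Weighted arithmetic–geometric mean for the product `D * U`; then `U ≤ n` makes the term in `U`
  -- linear, so that its stationary mean is of order `ε`.
  have h2 : 0 ≤ (κ * D - U) ^ 2 / κ := by positivity
  have h3 : (κ * D - U) ^ 2 / κ = κ * D ^ 2 - 2 * D * U + U ^ 2 / κ := by field_simp; ring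
  have h4 : U ^ 2 / κ ≤ n * U / κ := div_le_div_of_nonneg_right (by nlinarith) hκ.le
  have h5 : 4 * n / κ * U = 4 * (n * U / κ) := by ring
  rw [add_mul (4 * n / κ), h5]
  linarith

lemma integral_entrySum_arrivals (hν : ν ∈ doublyStochastic ℝ (Fin n))
    (hA : IsArrivalLaw A amax (ν - ε • ν)) :
    ∫ a, entrySum (realState a) ∂A.toMeasure = (1 - ε) * n := by
  rw [hA.integral_entrySum]
  have h := entrySum_of_mem_doublyStochastic hν
  simp only [entrySum, Matrix.sub_apply, Matrix.smul_apply, smul_eq_mul, Finset.sum_sub_distrib,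
    ← Finset.mul_sum] at h ⊢
  rw [h]; ring

/-- All terms in the new state stand on the left, as passing to stationary means requires. The
values `s = 1` and `s = -1` give the two halves of an absolute value. -/
lemma integral_marginForm_nextQueue_le (hn : 0 < n) (hν : ν ∈ doublyStochastic ℝ (Fin n))
    (hA : IsArrivalLaw A amax (ν - ε • ν)) {κ s : ℝ} (hκ : 0 < κ) (hs : |s| ≤ 1)
    (q : SwitchState n) (τ : Equiv.Perm (Fin n)) :
    ∫ a, (s * marginForm (realState (nextQueue q a τ)) (realState (nextQueue q a τ)) -
      4 * κ * coneDist (realState (nextQueue q a τ)) ^ 2 -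
      (4 * n / κ + 3) * entrySum (realState (nextQueue q a τ))) ∂A.toMeasure ≤
    s * marginForm (realState q) (realState q) -
      (s * (2 * ε / n) + (4 * n / κ + 3)) * entrySum (realState q) +
      (s * ((2 * n - 1) / n ^ 2 *
        (∑ i, ∑ j, Var[fun a : SwitchState n => (a i j : ℝ); A.toMeasure]) + ε ^ 2) +
        (4 * n / κ + 3) * (n * ε)) := by
  obtain ⟨c, hc⟩ : ∃ c, c = 4 * n / κ + 3 := ⟨_, rfl⟩
  set G : SwitchState n → ℝ := fun a => marginForm (realState q + (realState a - serviceMatrix τ))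
    (realState q + (realState a - serviceMatrix τ)) with hG
  rw [← hc]
  have hpt : ∀ a, s * marginForm (realState (nextQueue q a τ)) (realState (nextQueue q a τ)) -
      4 * κ * coneDist (realState (nextQueue q a τ)) ^ 2 -
      c * entrySum (realState (nextQueue q a τ)) ≤
      s * G a - c * entrySum (realState a) + c * (n - entrySum (realState q)) := by
    intro a
    have h1 := abs_marginForm_nextQueue_sub_le hn hκ q a τ
    rw [← hc] at h1
    set F := marginForm (realState (nextQueue q a τ)) (realState (nextQueue q a τ))
    have h2 : s * (F - G a) ≤ |F - G a| := by
      refine (le_abs_self _).trans ?_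
      rw [abs_mul]
      exact mul_le_of_le_one_left (abs_nonneg _) hs
    have h3 := h2.trans h1
    linarith
  refine (integral_mono (hA.integrable _) (hA.integrable _) hpt).trans ?_
  rw [integral_add (hA.integrable _) (hA.integrable _),
    integral_sub (hA.integrable _) (hA.integrable _), integral_const_mul, integral_const_mul,
    integral_entrySum_arrivals hν hA, integral_marginForm_arrivals hn hν hA]
  simp only [integral_const, probReal_univ, smul_eq_mul, one_mul]
  exact le_of_eq (by ring)

lemma mul_stationary_entrySum_sub_le (hn : 0 < n) (hν : ν ∈ doublyStochastic ℝ (Fin n))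
    (hA : IsArrivalLaw A amax (ν - ε • ν)) (hQ : IsStationaryLaw A S Q)
    (hmom : ∀ m : ℕ, Integrable (fun q => queueNorm q ^ m) Q.toMeasure) {κ s : ℝ} (hκ : 0 < κ)
    (hs : |s| ≤ 1) :
    s * (2 * ε / n * ∫ q, entrySum (realState q) ∂Q.toMeasure - ((2 * n - 1) / n ^ 2 *
      (∑ i, ∑ j, Var[fun a : SwitchState n => (a i j : ℝ); A.toMeasure]) + ε ^ 2)) ≤
      4 * κ * ∫ q, coneDist (realState q) ^ 2 ∂Q.toMeasure + (4 * n / κ + 3) * (n * ε) := by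
  have iF := (integrable_marginForm_realState hn hmom).const_mul s
  have iD := (integrable_coneDist_pow hmom 2).const_mul (4 * κ)
  have iT := integrable_entrySum_realState hmom
  have h := hQ.integral_le hA.finite_support ((iF.sub iD).sub (iT.const_mul (4 * n / κ + 3)))
    ((iF.sub (iT.const_mul (s * (2 * ε / n) + (4 * n / κ + 3)))).add (integrable_const _))
    fun q τ _ => integral_marginForm_nextQueue_le hn hν hA hκ hs q τ
  rw [integral_sub' (iF.sub iD) (iT.const_mul _), integral_sub' iF iD,
    integral_add' (iF.sub (iT.const_mul _)) (integrable_const _),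
    integral_sub' iF (iT.const_mul _)] at h
  simp only [integral_const_mul, integral_const, probReal_univ, smul_eq_mul, one_mul] at h
  linarith

/-- Stationarity of the quadratic form, up to the error due to unused service. -/
lemma abs_stationary_entrySum_sub_le (hn : 0 < n) (hν : ν ∈ doublyStochastic ℝ (Fin n))
    (hA : IsArrivalLaw A amax (ν - ε • ν)) (hQ : IsStationaryLaw A S Q)
    (hmom : ∀ m : ℕ, Integrable (fun q => queueNorm q ^ m) Q.toMeasure) {κ : ℝ} (hκ : 0 < κ) :
    |2 * ε / n * ∫ q, entrySum (realState q) ∂Q.toMeasure - ((2 * n - 1) / n ^ 2 *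
      (∑ i, ∑ j, Var[fun a : SwitchState n => (a i j : ℝ); A.toMeasure]) + ε ^ 2)| ≤
      4 * κ * ∫ q, coneDist (realState q) ^ 2 ∂Q.toMeasure + (4 * n / κ + 3) * (n * ε) := by
  refine abs_le'.2 ⟨?_, ?_⟩
  · have := mul_stationary_entrySum_sub_le hn hν hA hQ hmom hκ (s := 1) (by simp)
    rwa [one_mul] at this
  · have := mul_stationary_entrySum_sub_le hn hν hA hQ hmom hκ (s := -1) (by simp)
    rwa [neg_one_mul] at this

/-- On collapsed states all doubly stochastic weights agree. -/
lemma abs_integral_frob_sub_le (hn : 0 < n) {M : Matrix (Fin n) (Fin n) ℝ}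
    (hM : M ∈ doublyStochastic ℝ (Fin n))
    (hmom : ∀ m : ℕ, Integrable (fun q => queueNorm q ^ m) Q.toMeasure) :
    |∫ q, frob M (realState q) ∂Q.toMeasure - (∫ q, entrySum (realState q) ∂Q.toMeasure) / n| ≤
      2 * n * (1 + ∫ q, coneDist (realState q) ^ 2 ∂Q.toMeasure) := by
  have hn' : (n : ℝ) ≠ 0 := by positivity
  have hpt : ∀ q : SwitchState n, |frob M (realState q) - entrySum (realState q) / n| ≤
      2 * n * (1 + coneDist (realState q) ^ 2) := by
    intro q
    set x := realState q
    -- The uniform doubly stochastic matrix: its weight is `(∑ q)/n`, and on the cone it weighs the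
    -- same as `M`.
    set J : Fin n → Fin n → ℝ := fun _ _ => 1 / n with hJ
    have h1 : entrySum x / n = frob J x := by
      simp only [frob, hJ, ← Finset.mul_sum, entrySum]
      ring
    have h2 : frob (coneProj x) M = frob (coneProj x) J := by
      refine frob_eq_of_mem_collapseCone (coneProj_mem x) (fun i => ?_) fun j => ?_
      · rw [sum_row_of_mem_doublyStochastic hM]; simp [hJ, hn']
      · rw [sum_col_of_mem_doublyStochastic hM]; simp [hJ, hn']
    have h3 := abs_frob_le (abs_conePerp_le x) (fun i j => nonneg_of_mem_doublyStochastic hM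
      (i := i) (j := j))
    have h4 := abs_frob_le (y := J) (abs_conePerp_le x) (fun i j => by
      rw [hJ]; positivity)
    have h5 : entrySum J = n := by
      simp [entrySum, hJ, hn']
    rw [entrySum_of_mem_doublyStochastic hM] at h3
    rw [h5] at h4
    have h6 : frob M x - entrySum x / n = frob (conePerp x) M - frob (conePerp x) J := by
      rw [h1, frob_comm M, frob_comm J]
      have e1 : frob (conePerp x) M = frob x M - frob (coneProj x) M := frob_sub_left _ _ _
      have e2 : frob (conePerp x) J = frob x J - frob (coneProj x) J := frob_sub_left _ _ _
      linarith
    have h7 : coneDist x ≤ 1 + coneDist x ^ 2 := by nlinarith [sq_nonneg (coneDist x - 1)]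
    have h8 := mul_le_mul_of_nonneg_right h7 (Nat.cast_nonneg (α := ℝ) n)
    rw [h6]
    rw [abs_le] at *
    constructor <;> linarith [h3.1, h3.2, h4.1, h4.2]
  have i1 := integrable_frob_realState hmom M
  have i2 := (integrable_entrySum_realState hmom).div_const (n : ℝ)
  rw [← integral_div, ← integral_sub i1 i2]
  refine abs_integral_le_integral_abs.trans ?_
  refine (integral_mono (i1.sub i2).abs (((integrable_const (1 : ℝ)).add
    (integrable_coneDist_pow hmom 2)).const_mul (2 * (n : ℝ))) hpt).trans (le_of_eq ?_)
  simp only [Pi.add_apply]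
  rw [integral_const_mul, integral_add (integrable_const _) (integrable_coneDist_pow hmom 2)]
  simp

end HeavyTraffic

end

/-! ### Passage to the heavy traffic limit. -/

section Limit

variable {n : ℕ}

/-- The scaled mean of the total queue length in heavy traffic. -/
lemma tendsto_mul_integral_entrySum (hn : 0 < n)
    {ν : Matrix (Fin n) (Fin n) ℝ} {v : Fin n → Fin n → ℝ} (hν : ν ∈ doublyStochastic ℝ (Fin n))
    {amax : ℕ} {A : ℝ → PMF (SwitchState n)}
    (hA : ∀ ε ∈ Set.Ioo (0 : ℝ) 1, IsArrivalLaw (A ε) amax (ν - ε • ν))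
    (hv : ∀ i j, Tendsto (fun ε : ℝ => Var[fun a : SwitchState n => (a i j : ℝ); (A ε).toMeasure])
      (𝓝[>] 0) (𝓝 (v i j)))
    {S : ℝ → SwitchState n → PMF (Equiv.Perm (Fin n))} {Q : ℝ → PMF (SwitchState n)}
    (hQ : ∀ ε ∈ Set.Ioo (0 : ℝ) 1, IsStationaryLaw (A ε) (S ε) (Q ε))
    (hmom : ∀ ε ∈ Set.Ioo (0 : ℝ) 1, ∀ m : ℕ,
      Integrable (fun q => queueNorm q ^ m) (Q ε).toMeasure) {M : ℝ}
    (hM : ∀ᶠ ε in 𝓝[>] (0 : ℝ), ∫ q, coneDist (realState q) ^ 2 ∂(Q ε).toMeasure ≤ M) :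
    Tendsto (fun ε : ℝ => ε * ∫ q, entrySum (realState q) ∂(Q ε).toMeasure) (𝓝[>] 0)
      (𝓝 ((1 - 1 / (2 * (n : ℝ))) * ∑ i, ∑ j, v i j)) := by
  have hn' : (n : ℝ) ≠ 0 := by positivity
  have hid : Tendsto (fun ε : ℝ => ε) (𝓝[>] 0) (𝓝 0) := tendsto_id.mono_left nhdsWithin_le_nhds
  have hsqrt : Tendsto (fun ε : ℝ => √ε) (𝓝[>] 0) (𝓝 0) := by
    have := (Real.continuous_sqrt.tendsto 0).comp hid
    rwa [Real.sqrt_zero] at this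
  set V : ℝ → ℝ := fun ε => (2 * n - 1) / (n : ℝ) ^ 2 *
      (∑ i, ∑ j, Var[fun a : SwitchState n => (a i j : ℝ); (A ε).toMeasure]) + ε ^ 2 with hV
  have hVlim : Tendsto V (𝓝[>] 0) (𝓝 ((2 * n - 1) / (n : ℝ) ^ 2 * ∑ i, ∑ j, v i j)) := by
    have h1 := ((tendsto_finsetSum Finset.univ fun i _ => tendsto_finsetSum Finset.univ
      fun j _ => hv i j).const_mul ((2 * n - 1) / (n : ℝ) ^ 2)).add (hid.pow 2)
    simpa using h1
  have herr : Tendsto (fun ε => 2 * ε / n * ∫ q, entrySum (realState q) ∂(Q ε).toMeasure - V ε)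
      (𝓝[>] 0) (𝓝 0) := by
    -- With `κ = √ε` both error terms, of orders `κ` and `ε / κ`, are of order `√ε`.
    have hb : Tendsto (fun ε : ℝ => (4 * M + 4 * (n : ℝ) ^ 2) * √ε + 3 * n * ε) (𝓝[>] 0) (𝓝 0) := by
      simpa using (hsqrt.const_mul (4 * M + 4 * (n : ℝ) ^ 2)).add (hid.const_mul (3 * (n : ℝ)))
    refine squeeze_zero_norm' ?_ hb
    filter_upwards [hM, Ioo_mem_nhdsGT (zero_lt_one' ℝ)] with ε hεM hε
    have hs : 0 < √ε := Real.sqrt_pos.2 hε.1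
    refine (abs_stationary_entrySum_sub_le hn hν (hA ε hε) (hQ ε hε) (hmom ε hε) hs).trans ?_
    have h1 := mul_le_mul_of_nonneg_left hεM (by positivity : 0 ≤ 4 * √ε)
    have h2 : (4 * n / √ε + 3) * (n * ε) = 4 * n ^ 2 * √ε + 3 * n * ε := by
      have h3 : ε / √ε = √ε := Real.div_sqrt
      have h4 : (4 * n / √ε + 3) * (n * ε) = 4 * n ^ 2 * (ε / √ε) + 3 * n * ε := by ring
      rw [h4, h3]
    rw [h2]
    linarith
  have h := (herr.add hVlim).const_mul ((n : ℝ) / 2)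
  have e : (n : ℝ) / 2 * (0 + (2 * n - 1) / (n : ℝ) ^ 2 * ∑ i, ∑ j, v i j) =
      (1 - 1 / (2 * (n : ℝ))) * ∑ i, ∑ j, v i j := by
    field_simp
    ring
  rw [e] at h
  refine h.congr fun ε => ?_
  field_simp
  ring

end Limit

theorem mainTheorem9 (n : ℕ) (hn : 0 < n)
    (ν σ : Matrix (Fin n) (Fin n) ℝ)
    (hν : ν ∈ doublyStochastic ℝ (Fin n)) (hν_pos : ∀ i j, 0 < ν i j)
    (amax : ℕ) (A : ℝ → PMF (SwitchState n))
    (hA : ∀ ε ∈ Set.Ioo (0 : ℝ) 1, IsArrivalLaw (A ε) amax (ν - ε • ν))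
    (hσ : ∀ i j, Tendsto (fun ε : ℝ => Var[fun a : SwitchState n => (a i j : ℝ); (A ε).toMeasure])
      (𝓝[>] 0) (𝓝 (σ i j ^ 2)))
    (S : ℝ → SwitchState n → PMF (Equiv.Perm (Fin n)))
    (hS : ∀ ε ∈ Set.Ioo (0 : ℝ) 1, IsMaxWeight (S ε)) :
    (∀ ε ∈ Set.Ioo (0 : ℝ) 1, ∃! Q : PMF (SwitchState n), IsStationaryLaw (A ε) (S ε) Q) ∧
    ∀ Q : ℝ → PMF (SwitchState n),
      (∀ ε ∈ Set.Ioo (0 : ℝ) 1, IsStationaryLaw (A ε) (S ε) (Q ε)) →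
      (∀ ε ∈ Set.Ioo (0 : ℝ) 1, ∀ q₀ q : SwitchState n,
        Tendsto (fun t => queueLaw (A ε) (S ε) q₀ t q) atTop (𝓝 (Q ε q))) ∧
      (∀ ε ∈ Set.Ioo (0 : ℝ) 1, ∀ i j,
        Integrable (fun q : SwitchState n => (q i j : ℝ)) (Q ε).toMeasure) ∧
      Tendsto (fun ε : ℝ => ε * ∫ q, (∑ i, ∑ j, (q i j : ℝ)) ∂(Q ε).toMeasure)
        (𝓝[>] 0) (𝓝 ((1 - 1 / (2 * (n : ℝ))) * ∑ i, ∑ j, σ i j ^ 2)) ∧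
      Tendsto (fun ε : ℝ => ε * ∫ q, (∑ i, ∑ j, ν i j * (q i j : ℝ)) ∂(Q ε).toMeasure)
        (𝓝[>] 0) (𝓝 ((2 * (n : ℝ) - 1) / (2 * (n : ℝ) ^ 2) * ∑ i, ∑ j, σ i j ^ 2)) ∧
      ∀ π : Equiv.Perm (Fin n),
        Tendsto (fun ε : ℝ => ε * ∫ q, (∑ i, (q i (π i) : ℝ)) ∂(Q ε).toMeasure)
          (𝓝[>] 0) (𝓝 ((2 * (n : ℝ) - 1) / (2 * (n : ℝ) ^ 2) * ∑ i, ∑ j, σ i j ^ 2)) := by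
  have hstat := fun ε (hε : ε ∈ Set.Ioo (0 : ℝ) 1) =>
    exists_stationaryLaw hn hν hν_pos hε.1 (hA ε hε) (hS ε hε)
  refine ⟨fun ε hε => ?_, fun Q hQ => ?_⟩
  · obtain ⟨Q, hQ, -, -, huniq⟩ := hstat ε hε
    exact ⟨Q, hQ, huniq⟩
  have hmom : ∀ ε ∈ Set.Ioo (0 : ℝ) 1, ∀ m : ℕ,
      Integrable (fun q => queueNorm q ^ m) (Q ε).toMeasure := fun ε hε => by
    obtain ⟨Q', -, hmom, -, huniq⟩ := hstat ε hε
    rwa [huniq _ (hQ ε hε)]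
  obtain ⟨δ, hδ, hδν⟩ := exists_forall_le_of_pos hν_pos
  have hn0 : (0 : ℝ) < n := by exact_mod_cast hn
  obtain ⟨M, hM⟩ : ∃ M, ∀ᶠ ε in 𝓝[>] (0 : ℝ),
      ∫ q, coneDist (realState q) ^ 2 ∂(Q ε).toMeasure ≤ M := by
    obtain ⟨C, hC⟩ : ∃ C, C = (n : ℝ) ^ 2 * ((amax : ℝ) + 1) ^ 2 := ⟨_, rfl⟩
    refine ⟨(δ + (2 * C + 8 * C ^ 2) ^ 3 / δ ^ 2 + 2 * C ^ 2) / δ, ?_⟩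
    filter_upwards [Ioo_mem_nhdsGT (zero_lt_one' ℝ),
      Ioo_mem_nhdsGT (show (0 : ℝ) < δ / (2 * n) by positivity)] with ε hε hεδ
    exact integral_coneDist_sq_le hν hδ hδν hε.1
      ((le_div_iff₀ (by positivity)).1 hεδ.2.le) (hA ε hε) (hS ε hε) (hQ ε hε) (hmom ε hε) hC
  have htot := tendsto_mul_integral_entrySum hn hν hA hσ hQ hmom hM
  -- Both remaining limits are instances of this one: the matrix is `ν` itself or a permutation
  -- matrix.
  have hweight : ∀ M' ∈ doublyStochastic ℝ (Fin n),
      Tendsto (fun ε : ℝ => ε * ∫ q, frob M' (realState q) ∂(Q ε).toMeasure)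
        (𝓝[>] 0) (𝓝 ((2 * (n : ℝ) - 1) / (2 * (n : ℝ) ^ 2) * ∑ i, ∑ j, σ i j ^ 2)) := by
    intro M' hM'
    have hid : Tendsto (fun ε : ℝ => ε) (𝓝[>] 0) (𝓝 0) :=
      tendsto_id.mono_left nhdsWithin_le_nhds
    have herr : Tendsto (fun ε : ℝ => ε * (∫ q, frob M' (realState q) ∂(Q ε).toMeasure -
        (∫ q, entrySum (realState q) ∂(Q ε).toMeasure) / n)) (𝓝[>] 0) (𝓝 0) := by
      have hb : Tendsto (fun ε : ℝ => ε * (2 * n * (1 + M))) (𝓝[>] 0) (𝓝 0) := by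
        simpa using hid.mul_const (2 * n * (1 + M))
      refine squeeze_zero_norm' ?_ hb
      filter_upwards [hM, Ioo_mem_nhdsGT (zero_lt_one' ℝ)] with ε hεM hε
      rw [Real.norm_eq_abs, abs_mul, abs_of_pos hε.1]
      refine mul_le_mul_of_nonneg_left ?_ hε.1.le
      refine (abs_integral_frob_sub_le hn hM' (hmom ε hε)).trans ?_
      exact mul_le_mul_of_nonneg_left (by linarith) (by positivity)
    have h := herr.add (htot.div_const (n : ℝ))
    have e : 0 + (1 - 1 / (2 * (n : ℝ))) * (∑ i, ∑ j, σ i j ^ 2) / n =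
        (2 * (n : ℝ) - 1) / (2 * (n : ℝ) ^ 2) * ∑ i, ∑ j, σ i j ^ 2 := by
      field_simp
      ring
    rw [e] at h
    refine h.congr fun ε => ?_
    ring
  refine ⟨fun ε hε q₀ q => ?_, fun ε hε i j => integrable_realState (hmom ε hε) i j, htot,
    hweight ν hν, fun π => ?_⟩
  · obtain ⟨Q', -, -, hlim, huniq⟩ := hstat ε hε
    rw [huniq _ (hQ ε hε)]
    exact hlim q₀ q
  · refine (hweight (π.permMatrix ℝ) permMatrix_mem_doublyStochastic).congr fun ε => ?_
    simp only [frob, permMatrix_apply_eq_serviceMatrix]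
    simp [serviceMatrix, switchService, realState]
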